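/- A group $G$ is called a Jordan group if there is an integer $d>0$ such that every finite subgroup $H$ of $G$ contains a normal abelian subgroup whose index in $H$ is at most $d$; the least such $d$ is the Jordan constant $J_G$ of $G$. Let $p$ be a prime number, and let $D=D_{p,\infty}$ be the quaternion algebra over $\mathbb{Q}$ (that is, the central simple $\mathbb{Q}$-algebra of dimension $4$), unique up to isomorphism, that is ramified exactly at the places $p$ and $\infty$: $D\otimes_{\mathbb{Q}}\mathbb{R}$ is a division algebra, and, for a prime $\ell$, $D\otimes_{\mathbb{Q}}\mathbb{Q}_\ell$ is a division algebra if and only if $\ell=p$. Then the multiplicative group $D^\times$ is a Jordan group, and $$J_{D^\times}=\begin{cases}12 & \text{if and only if } p=2;\\ 2 & \text{if and only if } p=3;\\ 1 & \text{if and only if } p\ge 5.\end{cases}$$ -/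

import Mathlib

open scoped TensorProduct

/-- The natural number `d` is a Jordan bound for the group `G`: it is positive, and every finite
subgroup `H` of `G` contains a normal abelian subgroup whose index in `H` is at most `d`. -/
def IsJordanBound (G : Type*) [Group G] (d : ℕ) : Prop :=
  0 < d ∧ ∀ H : Subgroup G, Finite H →
    ∃ N : Subgroup H, N.Normal ∧ (∀ x ∈ N, ∀ y ∈ N, x * y = y * x) ∧ N.index ≤ d

/-- A Jordan group: one that has a Jordan bound. -/
def IsJordanGroup (G : Type*) [Group G] : Prop :=
  ∃ d : ℕ, IsJordanBound G d

/-- The Jordan constant of `G`: its least Jordan bound (meaningful for a Jordan group `G`;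
the value is `0` otherwise). -/
noncomputable def jordanConstant (G : Type*) [Group G] : ℕ :=
  sInf {d : ℕ | IsJordanBound G d}

/-- A quaternion algebra over a field `F`: a central simple `F`-algebra of dimension `4`. -/
structure IsQuaternionAlgebra (F D : Type*) [Field F] [Ring D] [Algebra F D] : Prop where
  isCentral : Algebra.IsCentral F D
  isSimpleRing : IsSimpleRing D
  finrank_eq_four : Module.finrank F D = 4

/-- For a completion `K` of `ℚ`, the algebra `D` over `ℚ` is ramified at the place given by `K`
if `K ⊗ D` is a division algebra. (A quaternion algebra is split there otherwise.) -/
def IsRamifiedOver (K D : Type*) [Field K] [Algebra ℚ K] [Ring D] [Algebra ℚ D] : Prop :=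
  Nontrivial (K ⊗[ℚ] D) ∧ ∀ x : K ⊗[ℚ] D, x ≠ 0 → IsUnit x

/-- `D` is (a copy of) `D_{p,∞}`: a quaternion algebra over `ℚ` whose set of ramified places
is exactly `{p, ∞}`. -/
structure IsQuaternionRamifiedAtPInfty (p : ℕ) (D : Type*) [Ring D] [Algebra ℚ D] : Prop where
  isQuaternionAlgebra : IsQuaternionAlgebra ℚ D
  ramified_infty : IsRamifiedOver ℝ D
  ramified_prime_iff : ∀ (l : ℕ) [Fact l.Prime], IsRamifiedOver ℚ_[l] D ↔ l = p

/-! ### Quaternion algebras and their base change -/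

section Division

variable {D : Type*} [Ring D] [Algebra ℚ D]

/-! Ramification at infinity makes `D` a definite algebra `(A, B)` with `A, B < 0`. An element of a
finite subgroup `H` then has reduced norm one, and its trace `x + x⁻¹` is a rational number integral
over `ℤ`, hence an integer in `[-2, 2]`, equal to `2` only at `x = 1`. So a finite subgroup is
controlled by an integer-valued trace `τ` obeying `τ(xy) + τ(xy⁻¹) = τ(x)τ(y)` (`IsTraceFunction`).

Upper bounds. If `x, y` in `H` do not commute and `κ` is the trace of their commutator, then `x -
x⁻¹` and `xy - yx` anticommute and have squares `τ(x)² - 4` and `κ - 2`, so `D = (τ(x)² - 4, κ - 2)`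
(`isRamifiedOver_iff_of_commutator_ne`). Fricke's formula for `κ` leaves `κ ∈ {0, -1, -2}` and very
few values of `τ(x)`, and explicit local zeros of the norm form eliminate most of them. Ramification
at `p ≥ 5` excludes every pair, so `H` is abelian. Ramification at `3` leaves `κ = -1`, and the
elements of nonzero trace form an abelian subgroup of index at most `2`. Ramification at `2` leaves
`κ ∈ {0, -2}`, and the elements of trace `±2` form a central subgroup of index at most `12`.

Lower bounds. For `p = 2, 3` the algebra has to be identified as `(-1, -1)` or `(-1, -3)` from its
ramification alone. Take an integral ternary form similar to the norm form on pure quaternions, of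
least determinant. At a prime `q` dividing that determinant, minimality forces the form to be
anisotropic over `ℚ_q` (`isRamifiedShape_of_minimal`, `IsRamifiedShape.eval_ne_zero`), so `q` is
ramified; moreover `q` is odd and divides the determinant only once. Hence the determinant is `1` or
`3`, Hermite reduction leaves three diagonal forms, and anisotropy at `2` discards the wrong ones.
The Hurwitz units, in which a normal abelian subgroup has at most two of at least `24` elements,
give `12`; a finite nonabelian group in `(-1, -3)` gives `2`. For `p ≥ 5` the lower bound `1` is
part of the definition of a Jordan bound. -/

theorem IsRamifiedOver.isDomain {K : Type*} [Field K] [Algebra ℚ K] (h : IsRamifiedOver K D) :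
    IsDomain D := by
  obtain ⟨hnt, hu⟩ := h
  have hinj : Function.Injective (Algebra.TensorProduct.includeRight : D →ₐ[ℚ] K ⊗[ℚ] D) :=
    Algebra.TensorProduct.includeRight_injective (algebraMap ℚ K).injective
  have : Nontrivial D := by
    by_contra hD
    rw [not_nontrivial_iff_subsingleton] at hD
    have h1 : (1 : K ⊗[ℚ] D) = 0 := by
      rw [← map_one (Algebra.TensorProduct.includeRight : D →ₐ[ℚ] K ⊗[ℚ] D),
        Subsingleton.elim (1 : D) 0, map_zero]
    exact one_ne_zero h1
  have : NoZeroDivisors (K ⊗[ℚ] D) := by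
    refine ⟨fun {a b} hab => ?_⟩
    by_cases ha : a = 0
    · exact Or.inl ha
    · exact Or.inr ((hu a ha).mul_right_eq_zero.mp hab)
  have : NoZeroDivisors D := hinj.noZeroDivisors _ (map_zero _) (map_mul _)
  exact NoZeroDivisors.to_isDomain D

variable [IsDomain D]

/-- A quaternion division algebra is not commutative, so its elements have degree at most two. -/
theorem IsQuaternionAlgebra.exists_quadratic (hD : IsQuaternionAlgebra ℚ D) (x : D) :
    ∃ t n : ℚ, x * x = t • x + n • (1 : D) := by
  have hfin : FiniteDimensional ℚ D :=
    Module.finite_of_finrank_pos (by rw [hD.finrank_eq_four]; norm_num)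
  let K : Subalgebra ℚ D := Algebra.adjoin ℚ {x}
  let _ : DivisionRing K := divisionRingOfFiniteDimensional ℚ K
  have hmul : Module.finrank ℚ K * Module.finrank K D = Module.finrank ℚ D :=
    Module.finrank_mul_finrank ℚ K D
  rw [hD.finrank_eq_four] at hmul
  have hcenter : Subalgebra.center ℚ D = ⊥ := le_bot_iff.mp hD.isCentral.out
  -- The degree of `ℚ[x]` divides `4` by the tower law; degree `4` would make `D = ℚ[x]`
  -- commutative, against centrality.
  have hne : Module.finrank ℚ K ≠ 4 := by
    intro h4
    have htop : K = ⊤ := by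
      apply Subalgebra.toSubmodule_injective
      rw [Algebra.top_toSubmodule]
      apply Submodule.eq_top_of_finrank_eq
      rw [hD.finrank_eq_four]
      exact h4
    have hcomm : ∀ a b : D, a * b = b * a := by
      intro a b
      have key : ∀ c : D, ∃ f : Polynomial ℚ, Polynomial.aeval x f = c := by
        intro c
        have hc : c ∈ K := htop ▸ Algebra.mem_top
        rw [show K = _ from Algebra.adjoin_singleton_eq_range_aeval ℚ x] at hc
        exact hc
      obtain ⟨f, rfl⟩ := key a
      obtain ⟨g, rfl⟩ := key b
      rw [← map_mul, ← map_mul, mul_comm]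
    have hct : Subalgebra.center ℚ D = ⊤ := by
      rw [eq_top_iff]
      intro a _
      rw [Subalgebra.mem_center_iff]
      exact fun b => hcomm b a
    have h1 := Subalgebra.finrank_bot (F := ℚ) (E := D)
    rw [← hcenter, hct, subalgebra_top_finrank_eq_submodule_top_finrank, finrank_top,
      hD.finrank_eq_four] at h1
    norm_num at h1
  have hle : Module.finrank ℚ K ≤ 2 := by
    have hdvd : Module.finrank ℚ K ∣ 4 := ⟨_, hmul.symm⟩
    have := Nat.le_of_dvd (by norm_num) hdvd
    interval_cases Module.finrank ℚ K <;> simp_all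
  let y : K := ⟨x, Algebra.self_mem_adjoin_singleton ℚ x⟩
  have hintegral : IsIntegral ℚ y := Algebra.IsIntegral.isIntegral y
  have hdeg : (minpoly ℚ y).natDegree < 3 :=
    lt_of_le_of_lt ((minpoly.natDegree_le y).trans hle) (by norm_num)
  have hsum := Polynomial.aeval_eq_sum_range' hdeg y
  rw [minpoly.aeval] at hsum
  have hsum' := congrArg (Subtype.val) hsum
  simp only [Finset.sum_range_succ, Finset.sum_range_zero, zero_add] at hsum'
  have hx : (0 : D) = (minpoly ℚ y).coeff 0 • (1 : D) + (minpoly ℚ y).coeff 1 • x +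
      (minpoly ℚ y).coeff 2 • (x * x) := by
    simpa [y, pow_two] using hsum'
  set c := (minpoly ℚ y).coeff
  by_cases h2 : c 2 = 0
  · by_cases h1 : c 1 = 0
    · exfalso
      have hm := minpoly.monic hintegral
      rw [h2, h1] at hx
      have h0 : c 0 = 0 := by
        have : c 0 • (1 : D) = 0 := by simpa using hx.symm
        exact (smul_eq_zero.mp this).resolve_right one_ne_zero
      have : (minpoly ℚ y).leadingCoeff = 0 := by
        have : (minpoly ℚ y).natDegree < 3 := hdeg
        rw [Polynomial.leadingCoeff]
        change c _ = 0
        interval_cases (minpoly ℚ y).natDegree <;> assumption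
      rw [hm.leadingCoeff] at this
      exact one_ne_zero this
    · refine ⟨-(c 0 / c 1), 0, ?_⟩
      have hx1 : x = (-(c 0 / c 1)) • (1 : D) := by
        have : c 1 • x = (-(c 0)) • (1 : D) := by
          rw [h2] at hx
          linear_combination (norm := module) -hx
        calc x = (c 1)⁻¹ • (c 1 • x) := by rw [smul_smul, inv_mul_cancel₀ h1, one_smul]
          _ = _ := by rw [this, smul_smul]; congr 1; field_simp
      nth_rw 1 [hx1]
      simp
  · refine ⟨-(c 1 / c 2), -(c 0 / c 2), ?_⟩
    calc x * x = (c 2)⁻¹ • (c 2 • (x * x)) := by rw [smul_smul, inv_mul_cancel₀ h2, one_smul]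
      _ = (c 2)⁻¹ • ((-(c 1)) • x + (-(c 0)) • (1 : D)) := by
        congr 1
        linear_combination (norm := module) -hx
      _ = _ := by
        rw [smul_add, smul_smul, smul_smul]
        congr 2 <;> field_simp

/-- Two anticommuting elements with rational squares identify a four-dimensional division algebra. -/
theorem nonempty_algEquiv_of_anticommuting (hD : Module.finrank ℚ D = 4) {i j : D} {A B : ℚ}
    (hi : i * i = A • (1 : D)) (hj : j * j = B • (1 : D)) (hij : j * i = -(i * j))
    (hi0 : i ≠ 0) (hj0 : j ≠ 0) :
    Nonempty (QuaternionAlgebra ℚ A 0 B ≃ₐ[ℚ] D) := by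
  have hfin : FiniteDimensional ℚ D :=
    Module.finite_of_finrank_pos (by rw [hD]; norm_num)
  let q : QuaternionAlgebra.Basis D A 0 B :=
    { i := i, j := j, k := i * j
      i_mul_i := by simp [hi]
      j_mul_j := hj
      i_mul_j := rfl
      j_mul_i := by simp [hij] }
  have hlin : ∀ a b : ℚ, a • (1 : D) + b • i = 0 → a = 0 ∧ b = 0 := by
    intro a b h
    have h1 : j * (a • (1 : D) + b • i) = 0 := by rw [h, mul_zero]
    have h2 : (a • (1 : D) + b • i) * j = 0 := by rw [h, zero_mul]
    simp only [mul_add, add_mul, mul_smul_comm, smul_mul_assoc, mul_one, one_mul, hij] at h1 h2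
    have ha : (2 * a) • j = 0 := by linear_combination (norm := module) h1 + h2
    have hb : (2 * b) • (i * j) = 0 := by linear_combination (norm := module) h2 - h1
    constructor
    · have := (smul_eq_zero.mp ha).resolve_right hj0
      linarith
    · have := (smul_eq_zero.mp hb).resolve_right (mul_ne_zero hi0 hj0)
      linarith
  have hinj : Function.Injective q.liftHom := by
    rw [injective_iff_map_eq_zero]
    intro x hx
    have hx' : x.re • (1 : D) + x.imI • i + x.imJ • j + x.imK • (i * j) = 0 := by
      simpa [QuaternionAlgebra.Basis.liftHom, QuaternionAlgebra.Basis.lift, q,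
        Algebra.algebraMap_eq_smul_one] using hx
    have hk : (i * j) * i = - (i * (i * j)) := by
      rw [mul_assoc, hij, mul_neg]
    have h1 : i * (x.re • (1 : D) + x.imI • i + x.imJ • j + x.imK • (i * j)) = 0 := by
      rw [hx', mul_zero]
    have h2 : (x.re • (1 : D) + x.imI • i + x.imJ • j + x.imK • (i * j)) * i = 0 := by
      rw [hx', zero_mul]
    simp only [mul_add, add_mul, mul_smul_comm, smul_mul_assoc, mul_one, one_mul, hij, hk] at h1 h2
    -- Left and right multiplication by `i` agree on `1, i` and differ by a sign on `j, ij`. Half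
    -- the sum and half the difference therefore separate the two halves of the relation.
    have h3 : i * (x.re • (1 : D) + x.imI • i) = 0 := by
      simp only [mul_add, mul_smul_comm, mul_one]
      linear_combination (norm := module) (1 / 2 : ℚ) • (h1 + h2)
    have h4 : i * ((x.imJ • (1 : D) + x.imK • i) * j) = 0 := by
      simp only [mul_add, add_mul, mul_smul_comm, smul_mul_assoc, one_mul]
      linear_combination (norm := module) (1 / 2 : ℚ) • (h1 - h2)
    have h5 := (mul_eq_zero.mp h3).resolve_left hi0
    have h6 := (mul_eq_zero.mp ((mul_eq_zero.mp h4).resolve_left hi0)).resolve_right hj0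
    obtain ⟨e1, e2⟩ := hlin _ _ h5
    obtain ⟨e3, e4⟩ := hlin _ _ h6
    ext <;> assumption
  have hsurj : Function.Surjective q.liftHom := by
    have := (LinearMap.injective_iff_surjective_of_finrank_eq_finrank
      (f := q.liftHom.toLinearMap)
      (by rw [QuaternionAlgebra.finrank_eq_four, hD])).mp hinj
    exact this
  exact ⟨AlgEquiv.ofBijective q.liftHom ⟨hinj, hsurj⟩⟩

/-- Completing the square in a noncentral element gives `i` with scalar square. Because `i²` is
central, any commutator `j = iy - yi` anticommutes with `i`. Then `j²` commutes with `i`, so the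
linear term in the quadratic relation of `j` must vanish. -/
theorem IsQuaternionAlgebra.exists_anticommuting (hD : IsQuaternionAlgebra ℚ D) :
    ∃ (i j : D) (A B : ℚ), i * i = A • (1 : D) ∧ j * j = B • (1 : D) ∧ j * i = -(i * j) ∧
      i ≠ 0 ∧ j ≠ 0 := by
  have hcenter : Subalgebra.center ℚ D = ⊥ := le_bot_iff.mp hD.isCentral.out
  obtain ⟨x, hx⟩ : ∃ x : D, x ∉ Subalgebra.center ℚ D := by
    by_contra! h
    have hct : Subalgebra.center ℚ D = ⊤ := by
      rw [eq_top_iff]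
      exact fun a _ => h a
    have h1 := Subalgebra.finrank_bot (F := ℚ) (E := D)
    rw [← hcenter, hct, subalgebra_top_finrank_eq_submodule_top_finrank, finrank_top,
      hD.finrank_eq_four] at h1
    norm_num at h1
  obtain ⟨t, n, htn⟩ := hD.exists_quadratic x
  set i : D := x - (t / 2) • (1 : D) with hi_def
  have hii : i * i = (n + t ^ 2 / 4) • (1 : D) := by
    simp only [hi_def, sub_mul, mul_sub, mul_smul_comm, smul_mul_assoc, one_mul, mul_one, htn]
    module
  obtain ⟨y, hy⟩ : ∃ y : D, y * i ≠ i * y := by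
    by_contra! h
    apply hx
    rw [Subalgebra.mem_center_iff]
    intro b
    have := h b
    simp only [hi_def, sub_mul, mul_sub, mul_smul_comm, smul_mul_assoc, one_mul, mul_one] at this
    linear_combination (norm := module) this
  have hi0 : i ≠ 0 := by
    intro h
    rw [h] at hy
    simp at hy
  set j : D := i * y - y * i with hj_def
  have hj0 : j ≠ 0 := fun h => hy (sub_eq_zero.mp h).symm
  have hij : j * i = -(i * j) := by
    have h1 : i * (i * y) = (n + t ^ 2 / 4) • y := by
      rw [← mul_assoc, hii, smul_mul_assoc, one_mul]
    have h2 : y * i * i = (n + t ^ 2 / 4) • y := by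
      rw [mul_assoc, hii, mul_smul_comm, mul_one]
    simp only [hj_def, sub_mul, mul_sub, h1, h2, mul_assoc i y i]
    abel
  obtain ⟨t', n', hj⟩ := hD.exists_quadratic j
  have hjj : i * (j * j) = (j * j) * i := by
    rw [mul_assoc, hij, mul_neg, ← mul_assoc j i j, hij, neg_mul, neg_neg, mul_assoc]
  have ht' : t' = 0 := by
    rw [hj] at hjj
    simp only [mul_add, add_mul, mul_smul_comm, smul_mul_assoc, one_mul, mul_one, hij] at hjj
    have : (2 * t') • (i * j) = 0 := by linear_combination (norm := module) hjj
    have := (smul_eq_zero.mp this).resolve_right (mul_ne_zero hi0 hj0)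
    linarith
  refine ⟨i, j, _, n', hii, ?_, hij, hi0, hj0⟩
  rw [hj, ht']
  module

end Division

/-! ### Extension of scalars, and ramification as anisotropy of the norm form. -/

section BaseChange

variable (K : Type*) [Field K] [Algebra ℚ K] (A B : ℚ)

/-- Base change of a quaternion algebra given by a standard presentation. -/
theorem QuaternionAlgebra.nonempty_baseChange :
    Nonempty (QuaternionAlgebra K (algebraMap ℚ K A) 0 (algebraMap ℚ K B) ≃ₐ[K]
      K ⊗[ℚ] QuaternionAlgebra ℚ A 0 B) := by
  have hs : ∀ (c : ℚ), algebraMap ℚ K c • (1 : K ⊗[ℚ] QuaternionAlgebra ℚ A 0 B) =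
      (1 : K) ⊗ₜ[ℚ] (c • (1 : QuaternionAlgebra ℚ A 0 B)) := by
    intro c
    rw [Algebra.TensorProduct.one_def, TensorProduct.smul_tmul', TensorProduct.tmul_smul,
      TensorProduct.smul_tmul', Algebra.smul_def, Algebra.smul_def]
    simp
  let s := QuaternionAlgebra.Basis.self ℚ (c₁ := A) (c₂ := 0) (c₃ := B)
  let q : QuaternionAlgebra.Basis (K ⊗[ℚ] QuaternionAlgebra ℚ A 0 B)
      (algebraMap ℚ K A) 0 (algebraMap ℚ K B) :=
    { i := 1 ⊗ₜ s.i, j := 1 ⊗ₜ s.j, k := 1 ⊗ₜ s.k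
      i_mul_i := by
        rw [Algebra.TensorProduct.tmul_mul_tmul, s.i_mul_i, hs]
        simp
      j_mul_j := by
        rw [Algebra.TensorProduct.tmul_mul_tmul, s.j_mul_j, hs]
        simp
      i_mul_j := by rw [Algebra.TensorProduct.tmul_mul_tmul, s.i_mul_j, one_mul]
      j_mul_i := by
        rw [Algebra.TensorProduct.tmul_mul_tmul, s.j_mul_i, one_mul]
        simp [TensorProduct.tmul_neg] }
  have hsurj : Function.Surjective q.liftHom := by
    intro z
    induction z using TensorProduct.induction_on with
    | zero => exact ⟨0, map_zero _⟩
    | add x y hx hy =>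
      obtain ⟨a, rfl⟩ := hx
      obtain ⟨b, rfl⟩ := hy
      exact ⟨a + b, map_add _ _ _⟩
    | tmul k h =>
      refine ⟨⟨k * algebraMap ℚ K h.re, k * algebraMap ℚ K h.imI, k * algebraMap ℚ K h.imJ,
        k * algebraMap ℚ K h.imK⟩, ?_⟩
      have hh : h = h.re • (1 : QuaternionAlgebra ℚ A 0 B) + h.imI • s.i + h.imJ • s.j +
          h.imK • s.k := by
        ext <;> simp [s]
      have hm : ∀ (c : ℚ) (v : QuaternionAlgebra ℚ A 0 B),
          (k * algebraMap ℚ K c) • ((1 : K) ⊗ₜ[ℚ] v) = k ⊗ₜ[ℚ] (c • v) := by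
        intro c v
        rw [TensorProduct.smul_tmul', TensorProduct.tmul_smul, TensorProduct.smul_tmul',
          Algebra.smul_def c k]
        simp [mul_comm]
      conv_rhs => rw [hh]
      simp only [QuaternionAlgebra.Basis.liftHom_apply, QuaternionAlgebra.Basis.lift, q,
        Algebra.algebraMap_eq_smul_one (A := K ⊗[ℚ] QuaternionAlgebra ℚ A 0 B),
        Algebra.TensorProduct.one_def, TensorProduct.tmul_add, hm]
  have hinj : Function.Injective q.liftHom := by
    have := (LinearMap.injective_iff_surjective_of_finrank_eq_finrank
      (f := q.liftHom.toLinearMap)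
      (by rw [QuaternionAlgebra.finrank_eq_four, Module.finrank_baseChange,
        QuaternionAlgebra.finrank_eq_four])).mpr hsurj
    exact this
  exact ⟨AlgEquiv.ofBijective q.liftHom ⟨hinj, hsurj⟩⟩

end BaseChange

/-- The norm form of the quaternion algebra `(α, β)` over `K` has no nontrivial zero. -/
def NormAnisotropic {K : Type*} [Field K] (α β : K) : Prop :=
  ∀ a b c d : K, a ^ 2 - α * b ^ 2 - β * c ^ 2 + α * β * d ^ 2 = 0 →
    a = 0 ∧ b = 0 ∧ c = 0 ∧ d = 0

/-- Both directions rest on `x * star x` being the norm form evaluated at `x`: a zero of the form is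
a zero divisor, and a nonzero value makes a multiple of `star x` the inverse. -/
theorem QuaternionAlgebra.forall_isUnit_iff {K : Type*} [Field K] (α β : K) :
    (∀ x : QuaternionAlgebra K α 0 β, x ≠ 0 → IsUnit x) ↔ NormAnisotropic α β := by
  constructor
  · intro h a b c d h0
    by_contra hne
    let x : QuaternionAlgebra K α 0 β := ⟨a, b, c, d⟩
    have hx : x ≠ 0 := by
      intro hx
      apply hne
      rw [QuaternionAlgebra.ext_iff] at hx
      simpa [x] using hx
    have hmul : x * star x = 0 := by
      ext <;> simp [x] <;> first | linear_combination h0 | ring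
    have := (h x hx).mul_right_eq_zero.mp hmul
    exact hx (star_eq_zero.mp this)
  · intro h x hx
    have hn : x.re ^ 2 - α * x.imI ^ 2 - β * x.imJ ^ 2 + α * β * x.imK ^ 2 ≠ 0 := by
      intro h0
      obtain ⟨h1, h2, h3, h4⟩ := h _ _ _ _ h0
      exact hx (QuaternionAlgebra.ext h1 h2 h3 h4)
    set n := x.re ^ 2 - α * x.imI ^ 2 - β * x.imJ ^ 2 + α * β * x.imK ^ 2 with hn_def
    have h1 : x * star x = n • 1 := by
      ext <;> simp [hn_def] <;> ring
    have h2 : star x * x = n • 1 := by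
      ext <;> simp [hn_def] <;> ring
    refine ⟨⟨x, n⁻¹ • star x, ?_, ?_⟩, rfl⟩
    · rw [mul_smul_comm, h1, smul_smul, inv_mul_cancel₀ hn, one_smul]
    · rw [smul_mul_assoc, h2, smul_smul, inv_mul_cancel₀ hn, one_smul]

theorem isRamifiedOver_iff_of_algEquiv {K D : Type*} [Field K] [Algebra ℚ K] [Ring D]
    [Algebra ℚ D] {A B : ℚ} (e : QuaternionAlgebra ℚ A 0 B ≃ₐ[ℚ] D) :
    IsRamifiedOver K D ↔ NormAnisotropic (algebraMap ℚ K A) (algebraMap ℚ K B) := by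
  obtain ⟨f⟩ := QuaternionAlgebra.nonempty_baseChange K A B
  let g := f.trans (Algebra.TensorProduct.congr (AlgEquiv.refl : K ≃ₐ[K] K) e)
  rw [← QuaternionAlgebra.forall_isUnit_iff]
  constructor
  · rintro ⟨-, h⟩ x hx
    have := h (g x) ((map_ne_zero_iff g g.injective).mpr hx)
    simpa using this.map g.symm
  · intro h
    refine ⟨g.symm.surjective.nontrivial, fun x hx => ?_⟩
    have := h (g.symm x) ((map_ne_zero_iff g.symm g.symm.injective).mpr hx)
    simpa using this.map g

theorem isRamifiedOver_iff_of_anticommuting {K D : Type*} [Field K] [Algebra ℚ K] [Ring D]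
    [Algebra ℚ D] [IsDomain D] (hD : Module.finrank ℚ D = 4) {i j : D} {A B : ℚ}
    (hi : i * i = A • (1 : D)) (hj : j * j = B • (1 : D)) (hij : j * i = -(i * j))
    (hi0 : i ≠ 0) (hj0 : j ≠ 0) :
    IsRamifiedOver K D ↔ NormAnisotropic (algebraMap ℚ K A) (algebraMap ℚ K B) := by
  obtain ⟨e⟩ := nonempty_algEquiv_of_anticommuting hD hi hj hij hi0 hj0
  exact isRamifiedOver_iff_of_algEquiv e

/-! ### Groups with an integral trace function -/

/-- An integer-valued function with the formal properties of the trace on a finite group of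
norm-one elements in a definite rational quaternion algebra. -/
structure IsTraceFunction {G : Type*} [Group G] (τ : G → ℤ) : Prop where
  neg_two_le : ∀ x, -2 ≤ τ x
  le_two : ∀ x, τ x ≤ 2
  map_mul_comm : ∀ x y, τ (x * y) = τ (y * x)
  map_mul_add : ∀ x y, τ (x * y) + τ (x * y⁻¹) = τ x * τ y
  eq_two_iff : ∀ x, τ x = 2 ↔ x = 1

/-! ### Finite case checks on the traces of `x`, `y` and `x * y`. -/

section TraceArithmetic

variable {s t u : ℤ} (ht : -2 ≤ t ∧ t ≤ 2) (hu : -2 ≤ u ∧ u ≤ 2)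
  (hd : s ^ 2 + t ^ 2 + u ^ 2 - s * t * u - 2 = 2 ∨ s ^ 2 + t ^ 2 + u ^ 2 - s * t * u - 2 = 0 ∨
        s ^ 2 + t ^ 2 + u ^ 2 - s * t * u - 2 = -2)
include hu hd

/-- Here and below `s, t, u` stand for the traces of `x, y, x * y`, and the polynomial in `hd` is
the trace of the commutator (see `map_commutator`). -/
theorem trace_mul_eq_two_or_neg_two (hx : s = 2 ∨ s = -2) (hy : t = 2 ∨ t = -2) :
    u = 2 ∨ u = -2 := by
  obtain ⟨b5, b6⟩ := hu
  rcases hx with rfl | rfl <;> rcases hy with rfl | rfl <;> interval_cases u <;> simp_all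

theorem trace_mul_eq_two_or_neg_two_or_zero (hx : s = 2 ∨ s = -2 ∨ s = 0)
    (hy : t = 2 ∨ t = -2 ∨ t = 0) : u = 2 ∨ u = -2 ∨ u = 0 := by
  obtain ⟨b5, b6⟩ := hu
  rcases hx with rfl | rfl | rfl <;> rcases hy with rfl | rfl | rfl <;>
    interval_cases u <;> simp_all

include ht in
theorem trace_commutator_eq_two (hx : s = 2 ∨ s = -2) :
    s ^ 2 + t ^ 2 + u ^ 2 - s * t * u - 2 = 2 := by
  obtain ⟨b3, b4⟩ := ht
  obtain ⟨b5, b6⟩ := hu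
  rcases hx with rfl | rfl <;> interval_cases t <;> interval_cases u <;> simp_all

end TraceArithmetic

theorem Subgroup.index_le_of_cover {G : Type*} [Group G] {N : Subgroup G} {n : ℕ} (c : Fin n → G)
    (hc : ∀ g, ∃ k, (c k)⁻¹ * g ∈ N) : N.index ≤ n := by
  have hs : Function.Surjective (fun k => (QuotientGroup.mk (c k) : G ⧸ N)) := by
    intro q
    induction q using QuotientGroup.induction_on with
    | H g =>
      obtain ⟨k, hk⟩ := hc g
      exact ⟨k, QuotientGroup.eq.mpr hk⟩
  have := Nat.card_le_card_of_surjective _ hs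
  rwa [Nat.card_fin] at this

namespace IsTraceFunction

variable {G : Type*} [Group G] {τ : G → ℤ} (h : IsTraceFunction τ)
include h

theorem map_one : τ 1 = 2 := (h.eq_two_iff 1).mpr rfl

theorem map_inv (x : G) : τ x⁻¹ = τ x := by
  have := h.map_mul_add 1 x
  rw [one_mul, one_mul, h.map_one] at this
  linarith

theorem map_conj (x y : G) : τ (x * y * x⁻¹) = τ y := by
  rw [h.map_mul_comm, inv_mul_cancel_left]

theorem map_mul_self (x : G) : τ (x * x) = τ x ^ 2 - 2 := by
  have := h.map_mul_add x x
  rw [mul_inv_cancel, h.map_one] at this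
  linarith

/-- Fricke's identity. It follows from `map_mul_add` applied to the pairs `(x, y x y⁻¹)`, `(x y, x
y⁻¹)` and `(x, y)`, after removing conjugations. -/
theorem map_commutator (x y : G) :
    τ (x * y * x⁻¹ * y⁻¹) = τ x ^ 2 + τ y ^ 2 + τ (x * y) ^ 2 - τ x * τ y * τ (x * y) - 2 := by
  have h1 := h.map_mul_add x (y * x * y⁻¹)
  have h2 := h.map_mul_add (x * y) (x * y⁻¹)
  have h3 := h.map_mul_add x y
  have e1 : x * (y * x * y⁻¹)⁻¹ = x * y * x⁻¹ * y⁻¹ := by group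
  have e2 : x * y * (x * y⁻¹)⁻¹ = x * (y * y) * x⁻¹ := by group
  have e3 : x * (y * x * y⁻¹) = x * y * (x * y⁻¹) := by group
  rw [e1, e3, h.map_conj] at h1
  rw [e2, h.map_conj, h.map_mul_self] at h2
  have h4 : τ (x * y⁻¹) = τ x * τ y - τ (x * y) := by linarith
  rw [h4] at h2
  linear_combination h1 - h2

theorem commute_iff (x y : G) : x * y = y * x ↔ τ (x * y * x⁻¹ * y⁻¹) = 2 := by
  rw [h.eq_two_iff, mul_inv_eq_one, mul_inv_eq_iff_eq_mul]

theorem normal_of_mem_iff {N : Subgroup G} {P : ℤ → Prop} (hN : ∀ x, x ∈ N ↔ P (τ x)) :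
    N.Normal := by
  refine ⟨fun n hn g => ?_⟩
  rw [hN, h.map_conj, ← hN]
  exact hn

/-- If all nontrivial commutators have trace `-1`, then the elements of nonzero trace form a normal
abelian subgroup of index at most two. -/
theorem exists_index_le_two
    (hκ : ∀ x y, τ (x * y * x⁻¹ * y⁻¹) = 2 ∨ τ (x * y * x⁻¹ * y⁻¹) = -1) :
    ∃ N : Subgroup G, N.Normal ∧ (∀ x ∈ N, ∀ y ∈ N, x * y = y * x) ∧ N.index ≤ 2 := by
  have hmul : ∀ x y, τ x ≠ 0 → τ y ≠ 0 → τ (x * y) ≠ 0 := by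
    intro x y hx hy hu
    have h1 := hκ x y
    rw [h.map_commutator, hu] at h1
    have b1 := h.neg_two_le x
    have b2 := h.le_two x
    have b3 := h.neg_two_le y
    have b4 := h.le_two y
    generalize τ x = s at *
    generalize τ y = t at *
    interval_cases s <;> interval_cases t <;> simp_all
  let N : Subgroup G :=
    { carrier := {x | τ x ≠ 0}
      mul_mem' := fun {x y} hx hy => hmul x y hx hy
      one_mem' := by simp [h.map_one]
      inv_mem' := fun {x} hx => by simpa [h.map_inv] using hx }
  have hN : ∀ x, x ∈ N ↔ τ x ≠ 0 := fun x => Iff.rfl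
  refine ⟨N, h.normal_of_mem_iff (P := fun k => k ≠ 0) hN, ?_, ?_⟩
  · intro x hx y hy
    rw [hN] at hx hy
    have hu := hmul x y hx hy
    rw [h.commute_iff]
    have h1 := hκ x y
    rw [h.map_commutator] at h1 ⊢
    have b1 := h.neg_two_le x
    have b2 := h.le_two x
    have b3 := h.neg_two_le y
    have b4 := h.le_two y
    have b5 := h.neg_two_le (x * y)
    have b6 := h.le_two (x * y)
    generalize τ x = s at *
    generalize τ y = t at *
    generalize τ (x * y) = u at *
    interval_cases s <;> interval_cases t <;> interval_cases u <;> simp_all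
  · by_cases hall : ∀ g, g ∈ N
    · refine (Subgroup.index_le_of_cover (n := 1) (fun _ => 1) fun g => ⟨0, hall _⟩).trans ?_
      norm_num
    · push Not at hall
      obtain ⟨a, ha⟩ := hall
      refine Subgroup.index_le_of_cover ![1, a] fun g => ?_
      by_cases hg : g ∈ N
      · exact ⟨0, by simpa using hg⟩
      · refine ⟨1, ?_⟩
        simp only [hN, not_not] at ha hg
        rw [hN]
        -- With `a`, `g` and `a⁻¹ g` all of trace zero, Fricke's identity would give a commutator of
        -- trace `-2`, which is excluded.
        intro hu
        have h1 := hκ a⁻¹ g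
        rw [h.map_commutator, h.map_inv, ha, hg] at h1
        simp at hu
        rw [hu] at h1
        norm_num at h1

/-- If all nontrivial commutators have trace `0` or `-2`, then there is a normal abelian subgroup
of index at most twelve. -/
theorem exists_index_le_twelve
    (hκ : ∀ x y, τ (x * y * x⁻¹ * y⁻¹) = 2 ∨ τ (x * y * x⁻¹ * y⁻¹) = 0 ∨
      τ (x * y * x⁻¹ * y⁻¹) = -2) :
    ∃ N : Subgroup G, N.Normal ∧ (∀ x ∈ N, ∀ y ∈ N, x * y = y * x) ∧ N.index ≤ 12 := by
  have hκ' : ∀ x y, ∃ s t u : ℤ, τ x = s ∧ τ y = t ∧ τ (x * y) = u ∧ τ (x * y⁻¹) = s * t - u ∧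
      -2 ≤ s ∧ s ≤ 2 ∧ -2 ≤ t ∧ t ≤ 2 ∧ -2 ≤ u ∧ u ≤ 2 ∧
      (s ^ 2 + t ^ 2 + u ^ 2 - s * t * u - 2 = 2 ∨ s ^ 2 + t ^ 2 + u ^ 2 - s * t * u - 2 = 0 ∨
        s ^ 2 + t ^ 2 + u ^ 2 - s * t * u - 2 = -2) := by
    intro x y
    have h1 := hκ x y
    rw [h.map_commutator] at h1
    exact ⟨_, _, _, rfl, rfl, rfl, by linarith [h.map_mul_add x y], h.neg_two_le _, h.le_two _,
      h.neg_two_le _, h.le_two _, h.neg_two_le _, h.le_two _, h1⟩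
  -- `Z` plays the role of `{1, -1}`, and `Q` that of a subgroup of the quaternion group of order
  -- eight.
  let Z : Subgroup G :=
    { carrier := {x | τ x = 2 ∨ τ x = -2}
      mul_mem' := by
        intro x y hx hy
        simp only [Set.mem_ofPred_eq] at hx hy ⊢
        obtain ⟨s, t, u, hs, ht, hu, -, b1, b2, b3, b4, b5, b6, hd⟩ := hκ' x y
        rw [hs] at hx
        rw [ht] at hy
        rw [hu]
        exact trace_mul_eq_two_or_neg_two ⟨b5, b6⟩ hd hx hy
      one_mem' := by simp [h.map_one]
      inv_mem' := fun {x} hx => by simpa [h.map_inv] using hx }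
  have hZ : ∀ x, x ∈ Z ↔ τ x = 2 ∨ τ x = -2 := fun x => Iff.rfl
  let Q : Subgroup G :=
    { carrier := {x | τ x = 2 ∨ τ x = -2 ∨ τ x = 0}
      mul_mem' := by
        intro x y hx hy
        simp only [Set.mem_ofPred_eq] at hx hy ⊢
        obtain ⟨s, t, u, hs, ht, hu, -, b1, b2, b3, b4, b5, b6, hd⟩ := hκ' x y
        rw [hs] at hx
        rw [ht] at hy
        rw [hu]
        exact trace_mul_eq_two_or_neg_two_or_zero ⟨b5, b6⟩ hd hx hy
      one_mem' := by simp [h.map_one]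
      inv_mem' := fun {x} hx => by simpa [h.map_inv] using hx }
  have hQ : ∀ x, x ∈ Q ↔ τ x = 2 ∨ τ x = -2 ∨ τ x = 0 := fun x => Iff.rfl
  have hZQ : ∀ x ∈ Q, x ∉ Z → τ x = 0 := by
    intro x hx hxZ
    rw [hQ] at hx
    rw [hZ] at hxZ
    tauto
  have hZcentral : ∀ z ∈ Z, ∀ x, z * x = x * z := by
    intro z hz x
    rw [h.commute_iff, h.map_commutator]
    rw [hZ] at hz
    obtain ⟨s, t, u, hs, ht, hu, -, b1, b2, b3, b4, b5, b6, hd⟩ := hκ' z x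
    rw [hs] at hz ⊢
    rw [ht, hu]
    exact trace_commutator_eq_two ⟨b3, b4⟩ ⟨b5, b6⟩ hd hz
  have hZnormal : Z.Normal := h.normal_of_mem_iff (P := fun k => k = 2 ∨ k = -2) hZ
  -- There is at most one element of trace `-2`, and it is an involution: `τ(ab) + τ(ab⁻¹) = 4`
  -- forces both summands to be `2`.
  have hneg : ∀ a b, τ a = -2 → τ b = -2 → a * b = 1 := by
    intro a b ha hb
    rw [← h.eq_two_iff]
    have h1 := h.map_mul_add a b
    have := h.le_two (a * b)
    have := h.le_two (a * b⁻¹)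
    rw [ha, hb] at h1
    linarith
  -- `Q` is covered by four cosets of `Z`
  have hcover : ∃ x ∈ Q, ∃ y ∈ Q, ∀ z ∈ Q, z ∈ Z ∨ x⁻¹ * z ∈ Z ∨ y⁻¹ * z ∈ Z ∨
      (x * y)⁻¹ * z ∈ Z := by
    by_cases hcomm : ∀ x ∈ Q, ∀ y ∈ Q, x * y = y * x
    · by_cases hQZ : ∀ x ∈ Q, x ∈ Z
      · exact ⟨1, one_mem _, 1, one_mem _, fun z hz => Or.inl (hQZ z hz)⟩
      · push Not at hQZ
        obtain ⟨x, hxQ, hxZ⟩ := hQZ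
        refine ⟨x, hxQ, 1, one_mem _, fun z hz => ?_⟩
        by_cases hzZ : z ∈ Z
        · exact Or.inl hzZ
        · refine Or.inr (Or.inl ?_)
          have hx0 := hZQ x hxQ hxZ
          have hz0 := hZQ z hz hzZ
          have h1 := (h.commute_iff _ _).mp (hcomm x⁻¹ (inv_mem hxQ) z hz)
          rw [h.map_commutator, h.map_inv, hx0, hz0] at h1
          rw [hZ]
          -- For commuting elements of trace zero, Fricke's identity reads `u² - 2 = 2`.
          have h2 : (τ (x⁻¹ * z) - 2) * (τ (x⁻¹ * z) + 2) = 0 := by linear_combination h1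
          rcases mul_eq_zero.mp h2 with h3 | h3
          · left; linarith
          · right; linarith
    · push Not at hcomm
      obtain ⟨x, hxQ, y, hyQ, hxy⟩ := hcomm
      refine ⟨x, hxQ, y, hyQ, fun z hz => ?_⟩
      by_contra! hcon
      obtain ⟨hzZ, hxz, hyz, hxyz⟩ := hcon
      have hxyZ : x * y ∉ Z := by
        intro hm
        have := hZcentral _ hm x
        exact hxy (mul_left_cancel (a := x) (by rw [← this, mul_assoc])).symm
      have hz0 := hZQ z hz hzZ
      -- If `z` avoided all four cosets, conjugation by each of `x`, `y` and `x * y` would multiply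
      -- it by the central element `ε` of trace `-2`. But the effects of `x` and `y` compose to `ε²
      -- = 1`, so `x * y` would fix `z`.
      have key : ∀ w ∈ Q, w ∉ Z → w⁻¹ * z ∉ Z → τ (w⁻¹ * z * w⁻¹⁻¹ * z⁻¹) = -2 := by
        intro w hw hwZ hwz
        rw [h.map_commutator, h.map_inv, hZQ w hw hwZ, hz0,
          hZQ _ (mul_mem (inv_mem hw) hz) hwz]
        norm_num
      have hxZ : x ∉ Z := fun hm => hxy (hZcentral x hm y)
      have hyZ : y ∉ Z := fun hm => hxy (hZcentral y hm x).symm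
      have k1 := key x hxQ hxZ hxz
      have k2 := key y hyQ hyZ hyz
      have k3 := key (x * y) (mul_mem hxQ hyQ) hxyZ hxyz
      set ε := x⁻¹ * z * x⁻¹⁻¹ * z⁻¹ with hε
      have hc : ∀ g, ε * g = g * ε := hZcentral ε (Or.inr k1)
      have e1 : x⁻¹ * z * x = ε * z := by rw [hε]; group
      have e2 : y⁻¹ * z * y = ε * z := by
        have : (y⁻¹ * z * y⁻¹⁻¹ * z⁻¹) = ε := by
          have h1 := hneg _ _ k2 k1
          have h2 := hneg _ _ k1 k1
          exact mul_right_cancel (h1.trans h2.symm)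
        rw [← this]; group
      have e3 : (x * y)⁻¹ * z * (x * y) = z := by
        calc (x * y)⁻¹ * z * (x * y) = y⁻¹ * (x⁻¹ * z * x) * y := by group
          _ = ε * (y⁻¹ * z * y) := by rw [e1, ← mul_assoc, ← hc]; group
          _ = (ε * ε) * z := by rw [e2]; exact (mul_assoc _ _ _).symm
          _ = z := by rw [hneg _ _ k1 k1, one_mul]
      have e4 : (x * y)⁻¹ * z * (x * y)⁻¹⁻¹ * z⁻¹ = 1 := by rw [inv_inv, e3, mul_inv_cancel]
      rw [e4, h.map_one] at k3
      norm_num at k3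
  obtain ⟨x, hxQ, y, hyQ, hxy⟩ := hcover
  -- `G` is covered by three cosets of `Q`
  have hcover' : ∃ a b : G, ∀ g, g ∈ Q ∨ a⁻¹ * g ∈ Q ∨ b⁻¹ * g ∈ Q := by
    by_cases hall : ∀ g, g ∈ Q
    · exact ⟨1, 1, fun g => Or.inl (hall g)⟩
    · push Not at hall
      obtain ⟨a, ha⟩ := hall
      -- Outside `Q` traces are `±1`, so `τ(ga) + τ(ga⁻¹) = τ(g)τ(a)` is odd. One of the two traces
      -- on the left is even, and an even trace means membership in `Q`.
      refine ⟨a⁻¹, a, fun g => ?_⟩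
      by_cases hg : g ∈ Q
      · exact Or.inl hg
      · right
        rw [hQ] at ha hg
        rw [hQ, hQ, inv_inv, h.map_mul_comm a, h.map_mul_comm a⁻¹]
        obtain ⟨s, t, u, hs, ht, hu, hu', b1, b2, b3, b4, b5, b6, -⟩ := hκ' g a
        rw [hs] at hg
        rw [ht] at ha
        rw [hu, hu']
        clear hs ht hu hu'
        interval_cases s <;> simp at hg <;> interval_cases t <;> simp at ha <;>
          interval_cases u <;> simp
  obtain ⟨a, b, hab⟩ := hcover'
  refine ⟨Z, hZnormal, fun x hx y _ => hZcentral x hx y, ?_⟩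
  let c : Fin 3 × Fin 4 → G := fun k => ![1, a, b] k.1 * ![1, x, y, x * y] k.2
  have hc : ∀ g, ∃ k, (c k)⁻¹ * g ∈ Z := by
    intro g
    have h1 : ∃ m : Fin 3, (![1, a, b] m)⁻¹ * g ∈ Q := by
      rcases hab g with h1 | h1 | h1
      · exact ⟨0, by simpa using h1⟩
      · exact ⟨1, by simpa using h1⟩
      · exact ⟨2, by simpa using h1⟩
    obtain ⟨m, hm⟩ := h1
    have h2 : ∃ n : Fin 4, (![1, x, y, x * y] n)⁻¹ * ((![1, a, b] m)⁻¹ * g) ∈ Z := by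
      rcases hxy _ hm with h2 | h2 | h2 | h2
      · exact ⟨0, by simpa using h2⟩
      · exact ⟨1, by simpa using h2⟩
      · exact ⟨2, by simpa using h2⟩
      · exact ⟨3, by simpa using h2⟩
    obtain ⟨n, hn⟩ := h2
    refine ⟨(m, n), ?_⟩
    simpa only [c, mul_inv_rev, mul_assoc] using hn
  refine Subgroup.index_le_of_cover (n := 3 * 4) (c ∘ finProdFinEquiv.symm) fun g => ?_
  obtain ⟨k, hk⟩ := hc g
  exact ⟨finProdFinEquiv k, by simpa using hk⟩

end IsTraceFunction

/-! ### Finite groups in definite rational quaternion algebras -/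

namespace QuaternionAlgebra

section Norm

variable {A B : ℚ}

/-- The reduced norm of the quaternion algebra `(A, B)` over `ℚ`. -/
def reducedNorm (x : QuaternionAlgebra ℚ A 0 B) : ℚ :=
  x.re ^ 2 - A * x.imI ^ 2 - B * x.imJ ^ 2 + A * B * x.imK ^ 2

theorem reducedNorm_mul (x y : QuaternionAlgebra ℚ A 0 B) :
    reducedNorm (x * y) = reducedNorm x * reducedNorm y := by
  simp only [reducedNorm, re_mul, imI_mul, imJ_mul, imK_mul]
  ring

theorem reducedNorm_one : reducedNorm (1 : QuaternionAlgebra ℚ A 0 B) = 1 := by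
  simp [reducedNorm]

theorem mul_star_eq_reducedNorm (x : QuaternionAlgebra ℚ A 0 B) :
    x * star x = reducedNorm x • 1 := by
  ext <;> simp [reducedNorm] <;> ring

/-- Relates the additive commutator, which serves as a quaternion generator, to the trace of the
group commutator. -/
theorem reducedNorm_commutator (x y : QuaternionAlgebra ℚ A 0 B) (hx : reducedNorm x = 1)
    (hy : reducedNorm y = 1) :
    reducedNorm (x * y - y * x) = 2 - 2 * (x * y * star x * star y).re := by
  have h : reducedNorm (x * y - y * x) = 2 * (reducedNorm x * reducedNorm y) -
      2 * (x * y * star x * star y).re := by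
    simp only [reducedNorm, re_mul, imI_mul, imJ_mul, imK_mul, re_sub, imI_sub, imJ_sub, imK_sub,
      re_star, imI_star, imJ_star, imK_star]
    ring
  rw [h, hx, hy]
  ring

variable (hA : A < 0) (hB : B < 0)
include hA hB

theorem reducedNorm_nonneg (x : QuaternionAlgebra ℚ A 0 B) : 0 ≤ reducedNorm x := by
  have h1 : 0 ≤ -A * x.imI ^ 2 := mul_nonneg (by linarith) (sq_nonneg _)
  have h2 : 0 ≤ -B * x.imJ ^ 2 := mul_nonneg (by linarith) (sq_nonneg _)
  have h3 : 0 ≤ A * B * x.imK ^ 2 := mul_nonneg (mul_pos_of_neg_of_neg hA hB).le (sq_nonneg _)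
  have h4 := sq_nonneg x.re
  unfold reducedNorm
  linarith

theorem re_sq_le_reducedNorm (x : QuaternionAlgebra ℚ A 0 B) : x.re ^ 2 ≤ reducedNorm x := by
  have h1 : 0 ≤ -A * x.imI ^ 2 := mul_nonneg (by linarith) (sq_nonneg _)
  have h2 : 0 ≤ -B * x.imJ ^ 2 := mul_nonneg (by linarith) (sq_nonneg _)
  have h3 : 0 ≤ A * B * x.imK ^ 2 := mul_nonneg (mul_pos_of_neg_of_neg hA hB).le (sq_nonneg _)
  unfold reducedNorm
  linarith

theorem eq_zero_of_reducedNorm_eq_re_sq {x : QuaternionAlgebra ℚ A 0 B}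
    (h : reducedNorm x = x.re ^ 2) : x.imI = 0 ∧ x.imJ = 0 ∧ x.imK = 0 := by
  have h1 : 0 ≤ -A * x.imI ^ 2 := mul_nonneg (by linarith) (sq_nonneg _)
  have h2 : 0 ≤ -B * x.imJ ^ 2 := mul_nonneg (by linarith) (sq_nonneg _)
  have h3 : 0 ≤ A * B * x.imK ^ 2 := mul_nonneg (mul_pos_of_neg_of_neg hA hB).le (sq_nonneg _)
  unfold reducedNorm at h
  have e1 : A * x.imI ^ 2 = 0 := by linarith
  have e2 : B * x.imJ ^ 2 = 0 := by linarith
  have e3 : A * B * x.imK ^ 2 = 0 := by linarith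
  simpa [hA.ne, hB.ne] using And.intro e1 (And.intro e2 e3)

theorem reducedNorm_eq_zero {x : QuaternionAlgebra ℚ A 0 B} : reducedNorm x = 0 ↔ x = 0 := by
  constructor
  · intro h
    have h0 := re_sq_le_reducedNorm hA hB x
    have hre : x.re = 0 := by
      rw [h] at h0
      exact pow_eq_zero_iff (two_ne_zero) |>.mp (le_antisymm h0 (sq_nonneg _))
    obtain ⟨h1, h2, h3⟩ := eq_zero_of_reducedNorm_eq_re_sq hA hB (x := x) (by rw [h, hre]; ring)
    exact QuaternionAlgebra.ext hre h1 h2 h3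
  · rintro rfl
    simp [reducedNorm]

theorem isDomain_of_neg : IsDomain (QuaternionAlgebra ℚ A 0 B) := by
  have : NoZeroDivisors (QuaternionAlgebra ℚ A 0 B) := by
    refine ⟨fun {a b} h => ?_⟩
    rw [← reducedNorm_eq_zero hA hB, reducedNorm_mul] at h
    simpa only [mul_eq_zero, reducedNorm_eq_zero hA hB] using h
  exact NoZeroDivisors.to_isDomain _

/-- The norm is a nonnegative rational number some positive power of which is `1`. -/
theorem reducedNorm_eq_one_of_isOfFinOrder {x : (QuaternionAlgebra ℚ A 0 B)ˣ}
    (hx : IsOfFinOrder x) : reducedNorm (x : QuaternionAlgebra ℚ A 0 B) = 1 := by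
  obtain ⟨n, hn, hxn⟩ := isOfFinOrder_iff_pow_eq_one.mp hx
  have hpow : ∀ k : ℕ, reducedNorm ((x : QuaternionAlgebra ℚ A 0 B) ^ k) =
      reducedNorm (x : QuaternionAlgebra ℚ A 0 B) ^ k := by
    intro k
    induction k with
    | zero => simp [reducedNorm_one]
    | succ k ih => rw [pow_succ, reducedNorm_mul, ih, pow_succ]
  have h1 := hpow n
  rw [← Units.val_pow_eq_pow_val, hxn, Units.val_one, reducedNorm_one] at h1
  exact (pow_eq_one_iff_of_nonneg (reducedNorm_nonneg hA hB _) hn.ne').mp h1.symm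

variable {H : Subgroup (QuaternionAlgebra ℚ A 0 B)ˣ} [Finite H]

theorem reducedNorm_eq_one_of_mem (x : H) : reducedNorm (x.1 : QuaternionAlgebra ℚ A 0 B) = 1 :=
  reducedNorm_eq_one_of_isOfFinOrder hA hB
    (H.subtype.isOfFinOrder (isOfFinOrder_of_finite x))

theorem coe_inv_eq_star (x : H) :
    ((x⁻¹ : H).1 : QuaternionAlgebra ℚ A 0 B) = star (x.1 : QuaternionAlgebra ℚ A 0 B) := by
  have h : (x.1 : QuaternionAlgebra ℚ A 0 B) * star (x.1 : QuaternionAlgebra ℚ A 0 B) = 1 := by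
    rw [mul_star_eq_reducedNorm, reducedNorm_eq_one_of_mem hA hB, one_smul]
  rw [Subgroup.coe_inv]
  exact Units.inv_eq_of_mul_eq_one_right h

/-- The scalar `2 re x = x + x⁻¹` preserves the `ℤ`-span of `H`, a nonzero finitely generated
module, so it is integral over `ℤ`; being rational, it is an integer. -/
theorem exists_int_trace (x : H) : ∃ s : ℤ, (s : ℚ) = 2 * (x.1 : QuaternionAlgebra ℚ A 0 B).re := by
  let N : Submodule ℤ (QuaternionAlgebra ℚ A 0 B) :=
    Submodule.span ℤ (Set.range fun h : H => (h.1 : QuaternionAlgebra ℚ A 0 B))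
  have hintegral : IsIntegral ℤ (2 * (x.1 : QuaternionAlgebra ℚ A 0 B).re) := by
    refine isIntegral_of_smul_mem_submodule N ?_ (Submodule.fg_span (Set.finite_range _)) _ ?_
    · intro hN
      have h1 : (1 : QuaternionAlgebra ℚ A 0 B) ∈ N := Submodule.subset_span ⟨1, by simp⟩
      rw [hN, Submodule.mem_bot] at h1
      exact one_ne_zero h1
    · intro n hn
      have hmem : ∀ y : H, (y.1 : QuaternionAlgebra ℚ A 0 B) * n ∈ N := by
        intro y
        induction hn using Submodule.span_induction with
        | mem z hz =>
          obtain ⟨w, rfl⟩ := hz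
          exact Submodule.subset_span ⟨y * w, by simp⟩
        | zero => simp
        | add a b _ _ ha hb => rw [mul_add]; exact add_mem ha hb
        | smul c a _ ha => rw [mul_smul_comm]; exact Submodule.smul_mem _ _ ha
      have hsum : (2 * (x.1 : QuaternionAlgebra ℚ A 0 B).re) • n =
          (x.1 : QuaternionAlgebra ℚ A 0 B) * n + ((x⁻¹ : H).1 : QuaternionAlgebra ℚ A 0 B) * n := by
        rw [coe_inv_eq_star hA hB, ← add_mul, self_add_star', coe_mul_eq_smul]
        simp
      rw [hsum]
      exact add_mem (hmem x) (hmem x⁻¹)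
  obtain ⟨s, hs⟩ := IsIntegrallyClosed.isIntegral_iff.mp hintegral
  exact ⟨s, by simpa using hs⟩

theorem exists_isTraceFunction : ∃ τ : H → ℤ, IsTraceFunction τ ∧
    ∀ x : H, (τ x : ℚ) = 2 * (x.1 : QuaternionAlgebra ℚ A 0 B).re := by
  choose τ hτ using exists_int_trace hA hB (H := H)
  have hbound : ∀ x : H, (x.1 : QuaternionAlgebra ℚ A 0 B).re ^ 2 ≤ 1 := fun x =>
    (re_sq_le_reducedNorm hA hB _).trans (reducedNorm_eq_one_of_mem hA hB x).le
  refine ⟨τ, ⟨fun x => ?_, fun x => ?_, fun x y => ?_, fun x y => ?_, fun x => ?_⟩, hτ⟩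
  · have h1 := (sq_le_one_iff_abs_le_one _).mp (hbound x)
    have h2 := (abs_le.mp h1).1
    have : (-2 : ℚ) ≤ τ x := by rw [hτ]; linarith
    exact_mod_cast this
  · have h1 := (sq_le_one_iff_abs_le_one _).mp (hbound x)
    have h2 := (abs_le.mp h1).2
    have : (τ x : ℚ) ≤ 2 := by rw [hτ]; linarith
    exact_mod_cast this
  · have : (τ (x * y) : ℚ) = τ (y * x) := by
      rw [hτ, hτ]
      simp only [Subgroup.coe_mul, Units.val_mul, re_mul]
      ring
    exact_mod_cast this
  · have : (τ (x * y) : ℚ) + τ (x * y⁻¹) = τ x * τ y := by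
      rw [hτ, hτ, hτ, hτ]
      have h1 := coe_inv_eq_star hA hB y
      rw [Subgroup.coe_mul, Subgroup.coe_mul, Units.val_mul, Units.val_mul, h1]
      simp only [re_mul, re_star, imI_star, imJ_star, imK_star]
      ring
    exact_mod_cast this
  · constructor
    · intro h
      have hre : (x.1 : QuaternionAlgebra ℚ A 0 B).re = 1 := by
        have := hτ x
        rw [h] at this
        push_cast at this
        linarith
      obtain ⟨h1, h2, h3⟩ := eq_zero_of_reducedNorm_eq_re_sq hA hB
        (x := (x.1 : QuaternionAlgebra ℚ A 0 B))
        (by rw [reducedNorm_eq_one_of_mem hA hB, hre]; norm_num)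
      apply Subtype.ext
      apply Units.ext
      exact QuaternionAlgebra.ext (by simpa using hre) (by simpa using h1) (by simpa using h2)
        (by simpa using h3)
    · rintro rfl
      have : (τ 1 : ℚ) = 2 := by
        rw [hτ]
        simp
      exact_mod_cast this

/-- The quaternion algebra generated by two noncommuting elements of a finite group. -/
theorem isRamifiedOver_iff_of_commutator_ne {K : Type*} [Field K] [Algebra ℚ K] {τ : H → ℤ}
    (hre : ∀ x : H, (τ x : ℚ) = 2 * (x.1 : QuaternionAlgebra ℚ A 0 B).re)
    {x y : H} (hxy : τ (x * y * x⁻¹ * y⁻¹) ≠ 2) :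
    IsRamifiedOver K (QuaternionAlgebra ℚ A 0 B) ↔
      NormAnisotropic ((τ x : K) ^ 2 - 4) ((τ (x * y * x⁻¹ * y⁻¹) : K) - 2) := by
  have := isDomain_of_neg hA hB
  set X : QuaternionAlgebra ℚ A 0 B := (x.1 : QuaternionAlgebra ℚ A 0 B) with hX
  set Y : QuaternionAlgebra ℚ A 0 B := (y.1 : QuaternionAlgebra ℚ A 0 B) with hY
  have hnX : reducedNorm X = 1 := reducedNorm_eq_one_of_mem hA hB x
  have hnY : reducedNorm Y = 1 := reducedNorm_eq_one_of_mem hA hB y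
  have hκ : (τ (x * y * x⁻¹ * y⁻¹) : ℚ) = 2 * (X * Y * star X * star Y).re := by
    rw [hre, hX, hY, ← coe_inv_eq_star hA hB, ← coe_inv_eq_star hA hB]
    simp
  have hN := reducedNorm_commutator X Y hnX hnY
  have hW : X * Y - Y * X ≠ 0 := by
    intro h0
    rw [h0, (reducedNorm_eq_zero hA hB).mpr rfl, ← hκ] at hN
    apply hxy
    have : (τ (x * y * x⁻¹ * y⁻¹) : ℚ) = 2 := by linarith
    exact_mod_cast this
  have hI : (2 : ℚ) • X.im ≠ 0 := by
    intro h0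
    have h1 : X.im = 0 := (smul_eq_zero.mp h0).resolve_left two_ne_zero
    apply hW
    rw [← re_add_im X, h1, add_zero, sub_eq_zero]
    exact coe_commutes _ _
  -- The generators are `i = X - star X` and `j = XY - YX`. Both are pure, so their squares are
  -- minus their norms.
  have hii : ((2 : ℚ) • X.im) * ((2 : ℚ) • X.im) = ((τ x : ℚ) ^ 2 - 4) • 1 := by
    rw [hre]
    unfold reducedNorm at hnX
    ext <;> simp <;> first | linear_combination (-4) * hnX | linear_combination (0 : ℚ) * hnX
  have hjj : (X * Y - Y * X) * (X * Y - Y * X) = ((τ (x * y * x⁻¹ * y⁻¹) : ℚ) - 2) • 1 := by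
    rw [hκ, show 2 * (X * Y * star X * star Y).re - 2 = -reducedNorm (X * Y - Y * X) by
      rw [hN]; ring]
    ext <;> simp [reducedNorm] <;> ring
  have hji : (X * Y - Y * X) * ((2 : ℚ) • X.im) = -(((2 : ℚ) • X.im) * (X * Y - Y * X)) := by
    ext <;> simp <;> ring
  rw [isRamifiedOver_iff_of_anticommuting (K := K) (QuaternionAlgebra.finrank_eq_four A 0 B) hii hjj hji
    hI hW]
  simp only [map_sub, map_pow, map_intCast, map_ofNat]

end Norm

end QuaternionAlgebra

/-! ### Zeros of norm forms over the `p`-adic numbers -/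

section Padic

theorem PadicInt.exists_sq_eq {p : ℕ} [Fact p.Prime] (a c : ℤ_[p])
    (h : ‖a ^ 2 - c‖ < ‖2 * a‖ ^ 2) : ∃ z : ℤ_[p], z ^ 2 = c := by
  have h' := hensels_lemma (R := ℤ_[p]) (F := (Polynomial.X ^ 2 - Polynomial.C c)) (a := a)
    (by simpa [one_add_one_eq_two] using h)
  obtain ⟨z, hz, -⟩ := h'
  refine ⟨z, ?_⟩
  simpa [sub_eq_zero] using hz

/-- Over the field with `p` elements a conic of this kind has a point by counting. Since `p` does
not divide `β`, one of its coordinates is a unit, and Hensel's lemma lifts the point in that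
coordinate. -/
theorem Padic.exists_sq_add_mul_sq_add_eq_zero {p : ℕ} [Fact p.Prime] (hp2 : p ≠ 2) {α β : ℤ}
    (hα : ¬ (p : ℤ) ∣ α) (hβ : ¬ (p : ℤ) ∣ β) :
    ∃ a b : ℚ_[p], a ^ 2 + α * b ^ 2 + β = 0 := by
  have hp := Fact.out (p := p.Prime)
  have hodd : p % 2 = 1 := hp.eq_two_or_odd.resolve_left hp2
  have hα' : (α : ZMod p) ≠ 0 := by rwa [Ne, ZMod.intCast_zmod_eq_zero_iff_dvd]
  have hp2' : ¬ (p : ℤ) ∣ 2 := by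
    intro h
    have := Int.le_of_dvd (by norm_num) h
    have := hp.two_le
    omega
  obtain ⟨x, y, hxy⟩ := FiniteField.exists_root_sum_quadratic (R := ZMod p)
    (f := Polynomial.X ^ 2)
    (g := Polynomial.C (α : ZMod p) * Polynomial.X ^ 2 + Polynomial.C 0 * Polynomial.X +
      Polynomial.C (β : ZMod p))
    (by simp) (Polynomial.degree_quadratic hα') (by rw [ZMod.card]; exact hodd)
  obtain ⟨a, rfl⟩ := ZMod.intCast_surjective x
  obtain ⟨b, rfl⟩ := ZMod.intCast_surjective y
  have hdvd : (p : ℤ) ∣ a ^ 2 + α * b ^ 2 + β := by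
    rw [← ZMod.intCast_zmod_eq_zero_iff_dvd]
    push_cast
    simpa [add_assoc] using hxy
  have hprime : Prime (p : ℤ) := Nat.prime_iff_prime_int.mp hp
  have hunit : ∀ k : ℤ, ¬ (p : ℤ) ∣ k → ‖(k : ℤ_[p])‖ = 1 := by
    intro k hk
    exact le_antisymm (PadicInt.norm_le_one _)
      (not_lt.mp fun h => hk ((PadicInt.norm_int_lt_one_iff_dvd k).mp h))
  by_cases ha : (p : ℤ) ∣ a
  · have hb : ¬ (p : ℤ) ∣ b := by
      intro hb
      apply hβ
      have : β = (a ^ 2 + α * b ^ 2 + β) - a * a - α * b * b := by ring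
      rw [this]
      exact dvd_sub (dvd_sub hdvd (ha.mul_right _)) (hb.mul_left _)
    -- Solving for the second coordinate: `z` lifts `α * b`, so that `(z / α)² = -(a² + β) / α`.
    obtain ⟨z, hz⟩ := PadicInt.exists_sq_eq (p := p) ((α * b : ℤ) : ℤ_[p])
      ((-α * (a ^ 2 + β) : ℤ) : ℤ_[p]) (by
        have e1 : (((α * b : ℤ) : ℤ_[p]) ^ 2 - ((-α * (a ^ 2 + β) : ℤ) : ℤ_[p])) =
            ((α * (a ^ 2 + α * b ^ 2 + β) : ℤ) : ℤ_[p]) := by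
          push_cast
          ring
        have e2 : (2 : ℤ_[p]) * ((α * b : ℤ) : ℤ_[p]) = ((2 * (α * b) : ℤ) : ℤ_[p]) := by
          push_cast
          ring
        rw [e1, e2, hunit (2 * (α * b)), one_pow]
        · exact (PadicInt.norm_int_lt_one_iff_dvd _).mpr (hdvd.mul_left _)
        · intro h
          rcases hprime.dvd_or_dvd h with h | h
          · exact hp2' h
          · exact (hprime.dvd_or_dvd h).elim hα hb)
    have hα0 : (α : ℚ_[p]) ≠ 0 := by
      intro h
      apply hα
      have : α = 0 := by exact_mod_cast h
      simp [this]
    refine ⟨a, (z : ℚ_[p]) / α, ?_⟩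
    have hz' : (z : ℚ_[p]) ^ 2 = -α * (a ^ 2 + β) := by
      have := congrArg (fun w : ℤ_[p] => (w : ℚ_[p])) hz
      push_cast at this
      exact this
    rw [div_pow, hz']
    field_simp
    ring
  · obtain ⟨z, hz⟩ := PadicInt.exists_sq_eq (p := p) ((a : ℤ) : ℤ_[p])
      ((-(α * b ^ 2 + β) : ℤ) : ℤ_[p]) (by
        have e1 : (((a : ℤ) : ℤ_[p]) ^ 2 - ((-(α * b ^ 2 + β) : ℤ) : ℤ_[p])) =
            ((a ^ 2 + α * b ^ 2 + β : ℤ) : ℤ_[p]) := by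
          push_cast
          ring
        have e2 : (2 : ℤ_[p]) * ((a : ℤ) : ℤ_[p]) = ((2 * a : ℤ) : ℤ_[p]) := by
          push_cast
          ring
        rw [e1, e2, hunit (2 * a), one_pow]
        · exact (PadicInt.norm_int_lt_one_iff_dvd _).mpr hdvd
        · exact fun h => (hprime.dvd_or_dvd h).elim hp2' ha)
    refine ⟨z, b, ?_⟩
    have hz' : (z : ℚ_[p]) ^ 2 = -(α * b ^ 2 + β) := by
      have := congrArg (fun w : ℤ_[p] => (w : ℚ_[p])) hz
      push_cast at this
      exact this
    rw [hz']
    ring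

/-- `-7` is `1` modulo `8`. This root splits at `2` the algebras `(-4, -3)` and `(-3, -3)` that a
commutator of trace `-1` would produce. -/
theorem Padic.exists_sq_eq_neg_seven : ∃ a : ℚ_[2], a ^ 2 = -7 := by
  obtain ⟨z, hz⟩ := PadicInt.exists_sq_eq (p := 2) 1 (-7) (by
    have h8 : (1 : ℤ_[2]) ^ 2 - -7 = ((2 : ℕ) : ℤ_[2]) ^ 3 := by norm_num
    have h2 : (2 : ℤ_[2]) * 1 = ((2 : ℕ) : ℤ_[2]) := by norm_num
    rw [h8, h2, norm_pow, PadicInt.norm_p]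
    norm_num)
  refine ⟨z, ?_⟩
  have := congrArg (fun w : ℤ_[2] => (w : ℚ_[2])) hz
  push_cast at this
  exact this

/-- `-2` is `1` modulo `3`. This root splits at `3` every algebra coming from a commutator of trace
`0` or `-2`. -/
theorem Padic.exists_sq_eq_neg_two : ∃ a : ℚ_[3], a ^ 2 = -2 := by
  obtain ⟨z, hz⟩ := PadicInt.exists_sq_eq (p := 3) 1 (-2) (by
    have h3 : (1 : ℤ_[3]) ^ 2 - -2 = ((3 : ℕ) : ℤ_[3]) := by norm_num
    have h2 : ‖(2 : ℤ_[3]) * 1‖ = 1 := by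
      rw [mul_one]
      refine le_antisymm (PadicInt.norm_le_one _) (not_lt.mp fun h => ?_)
      have h' : ‖((2 : ℤ) : ℤ_[3])‖ < 1 := by exact_mod_cast h
      rw [PadicInt.norm_int_lt_one_iff_dvd] at h'
      norm_num at h'
    rw [h3, h2, PadicInt.norm_p]
    norm_num)
  refine ⟨z, ?_⟩
  have := congrArg (fun w : ℤ_[3] => (w : ℚ_[3])) hz
  push_cast at this
  exact this

end Padic

/-! ### Jordan bounds for finite groups in the ramified quaternion algebras -/

section UpperBound

/-- Possible traces of an element and of a nontrivial commutator with it. -/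
theorem IsTraceFunction.trace_cases {G : Type*} [Group G] {τ : G → ℤ} (h : IsTraceFunction τ)
    {x y : G} (hxy : τ (x * y * x⁻¹ * y⁻¹) ≠ 2) :
    ((τ x = 0 ∨ τ x ^ 2 = 1) ∧
      (τ (x * y * x⁻¹ * y⁻¹) = 0 ∨ τ (x * y * x⁻¹ * y⁻¹) = -1)) ∨
    (τ x = 0 ∧ τ (x * y * x⁻¹ * y⁻¹) = -2) := by
  have hle := h.le_two (x * y * x⁻¹ * y⁻¹)
  rw [h.map_commutator] at hxy hle ⊢
  have b1 := h.neg_two_le x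
  have b2 := h.le_two x
  have b3 := h.neg_two_le y
  have b4 := h.le_two y
  have b5 := h.neg_two_le (x * y)
  have b6 := h.le_two (x * y)
  generalize τ (x * y) = u at *
  generalize τ x = s at *
  generalize τ y = t at *
  clear h
  interval_cases s <;> interval_cases t <;> interval_cases u <;> simp_all

variable {A B : ℚ} (hA : A < 0) (hB : B < 0)
include hA hB

theorem isJordanBound_twelve (hram : IsRamifiedOver ℚ_[2] (QuaternionAlgebra ℚ A 0 B)) :
    IsJordanBound (QuaternionAlgebra ℚ A 0 B)ˣ 12 := by
  refine ⟨by norm_num, fun H hH => ?_⟩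
  obtain ⟨τ, hτ, hre⟩ := QuaternionAlgebra.exists_isTraceFunction hA hB (H := H)
  refine hτ.exists_index_le_twelve fun x y => ?_
  by_cases h2 : τ (x * y * x⁻¹ * y⁻¹) = 2
  · exact Or.inl h2
  right
  have hcases := hτ.trace_cases h2
  have haniso := (QuaternionAlgebra.isRamifiedOver_iff_of_commutator_ne hA hB hre h2).mp hram
  by_contra! hne
  have hκ : τ (x * y * x⁻¹ * y⁻¹) = -1 := by tauto
  rw [hκ] at haniso hcases
  obtain ⟨a, ha⟩ := Padic.exists_sq_eq_neg_seven
  have hs : τ x = 0 ∨ τ x ^ 2 = 1 := by tauto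
  rcases hs with hs | hs
  · rw [hs] at haniso
    have := (haniso a 2⁻¹ 1 2⁻¹ (by rw [ha]; norm_num)).2.2.1
    exact one_ne_zero this
  · have hs' : ((τ x : ℤ) : ℚ_[2]) ^ 2 = 1 := by exact_mod_cast hs
    rw [hs'] at haniso
    have := (haniso a 1 1 3⁻¹ (by rw [ha]; norm_num)).2.2.1
    exact one_ne_zero this

theorem isJordanBound_two (hram : IsRamifiedOver ℚ_[3] (QuaternionAlgebra ℚ A 0 B)) :
    IsJordanBound (QuaternionAlgebra ℚ A 0 B)ˣ 2 := by
  refine ⟨by norm_num, fun H hH => ?_⟩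
  obtain ⟨τ, hτ, hre⟩ := QuaternionAlgebra.exists_isTraceFunction hA hB (H := H)
  refine hτ.exists_index_le_two fun x y => ?_
  by_cases h2 : τ (x * y * x⁻¹ * y⁻¹) = 2
  · exact Or.inl h2
  right
  have haniso := (QuaternionAlgebra.isRamifiedOver_iff_of_commutator_ne hA hB hre h2).mp hram
  obtain ⟨a, ha⟩ := Padic.exists_sq_eq_neg_two
  rcases hτ.trace_cases h2 with ⟨-, hκ | hκ⟩ | ⟨hs, hκ⟩
  · rw [hκ] at haniso
    have := (haniso a 0 1 0 (by rw [ha]; norm_num)).2.2.1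
    exact absurd this one_ne_zero
  · exact hκ
  · rw [hκ, hs] at haniso
    have := (haniso a 2⁻¹ 2⁻¹ 0 (by rw [ha]; norm_num)).2.1
    norm_num at this

theorem isJordanBound_one {p : ℕ} [Fact p.Prime] (hp : 5 ≤ p)
    (hram : IsRamifiedOver ℚ_[p] (QuaternionAlgebra ℚ A 0 B)) :
    IsJordanBound (QuaternionAlgebra ℚ A 0 B)ˣ 1 := by
  refine ⟨by norm_num, fun H hH => ?_⟩
  obtain ⟨τ, hτ, hre⟩ := QuaternionAlgebra.exists_isTraceFunction hA hB (H := H)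
  refine ⟨⊤, inferInstance, fun x _ y _ => ?_, by simp⟩
  rw [hτ.commute_iff]
  by_contra h2
  have haniso := (QuaternionAlgebra.isRamifiedOver_iff_of_commutator_ne hA hB hre h2).mp hram
  have hprime : Prime (p : ℤ) := Nat.prime_iff_prime_int.mp Fact.out
  -- The coefficients `4 - τ(x)²` and `2 - κ` lie in `{3, 4}` and `{2, 3, 4}`, hence are units at `p
  -- ≥ 5`.
  have hsmall : ∀ k : ℤ, 0 < k → k < 5 → ¬ (p : ℤ) ∣ k := by
    intro k h0 h5 hk
    have := Int.le_of_dvd h0 hk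
    omega
  have hα : ¬ (p : ℤ) ∣ 4 - τ x ^ 2 := by
    rcases hτ.trace_cases h2 with ⟨hs | hs, -⟩ | ⟨hs, -⟩ <;> rw [hs] <;>
      exact hsmall _ (by norm_num) (by norm_num)
  have hβ : ¬ (p : ℤ) ∣ 2 - τ (x * y * x⁻¹ * y⁻¹) := by
    rcases hτ.trace_cases h2 with ⟨-, hκ | hκ⟩ | ⟨-, hκ⟩ <;> rw [hκ] <;>
      exact hsmall _ (by norm_num) (by norm_num)
  obtain ⟨a, b, hab⟩ := Padic.exists_sq_add_mul_sq_add_eq_zero (by omega) hα hβ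
  have := (haniso a b 1 0 (by push_cast at hab; linear_combination hab)).2.2.1
  exact one_ne_zero this

end UpperBound

/-! ### Reduction of integral ternary quadratic forms -/

/-- Similarity of rational ternary quadratic forms, with a positive similarity factor. -/
def TernarySimilar (F G : Matrix (Fin 3) (Fin 3) ℚ) : Prop :=
  ∃ c : ℚ, 0 < c ∧ ∃ M : Matrix (Fin 3) (Fin 3) ℚ, M.det ≠ 0 ∧ G = c • (M.transpose * F * M)

theorem TernarySimilar.trans {F G H : Matrix (Fin 3) (Fin 3) ℚ} (h₁ : TernarySimilar F G)
    (h₂ : TernarySimilar G H) : TernarySimilar F H := by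
  obtain ⟨c, hc, M, hM, rfl⟩ := h₁
  obtain ⟨d, hd, L, hL, rfl⟩ := h₂
  refine ⟨d * c, mul_pos hd hc, M * L, by rw [Matrix.det_mul]; exact mul_ne_zero hM hL, ?_⟩
  simp only [Matrix.transpose_mul, Matrix.mul_smul, Matrix.smul_mul, smul_smul, Matrix.mul_assoc]

/-- The integral ternary form `a x² + b y² + c z² + 2 r y z + 2 s x z + 2 t x y`. -/
structure TernaryForm where
  a : ℤ
  b : ℤ
  c : ℤ
  r : ℤ
  s : ℤ
  t : ℤ

namespace TernaryForm

/-- The Gram determinant. -/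
def det (f : TernaryForm) : ℤ :=
  f.a * f.b * f.c + 2 * f.r * f.s * f.t - f.a * f.r ^ 2 - f.b * f.s ^ 2 - f.c * f.t ^ 2

/-- The leading binary minor of the Gram matrix. -/
def minor (f : TernaryForm) : ℤ := f.a * f.b - f.t ^ 2

/-- The Gram matrix. -/
def toMatrix (f : TernaryForm) : Matrix (Fin 3) (Fin 3) ℚ :=
  !![(f.a : ℚ), f.t, f.s; (f.t : ℚ), f.b, f.r; (f.s : ℚ), f.r, f.c]

/-- The value of the form, in an arbitrary commutative ring. -/
def eval {R : Type*} [CommRing R] (f : TernaryForm) (x y z : R) : R :=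
  f.a * x ^ 2 + f.b * y ^ 2 + f.c * z ^ 2 + 2 * f.r * (y * z) + 2 * f.s * (x * z) +
    2 * f.t * (x * y)

theorem det_toMatrix (f : TernaryForm) : f.toMatrix.det = f.det := by
  simp [toMatrix, det, Matrix.det_fin_three]
  ring

theorem similar_swap_first_second (f : TernaryForm) :
    TernarySimilar f.toMatrix (toMatrix ⟨f.b, f.a, f.c, f.s, f.r, f.t⟩) := by
  refine ⟨1, one_pos, !![0, 1, 0; 1, 0, 0; 0, 0, 1], by simp [Matrix.det_fin_three], ?_⟩
  ext i j
  fin_cases i <;> fin_cases j <;>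
    simp [toMatrix, Matrix.mul_apply, Fin.sum_univ_three]

theorem similar_swap_first_third (f : TernaryForm) :
    TernarySimilar f.toMatrix (toMatrix ⟨f.c, f.b, f.a, f.t, f.s, f.r⟩) := by
  refine ⟨1, one_pos, !![0, 0, 1; 0, 1, 0; 1, 0, 0], by simp [Matrix.det_fin_three], ?_⟩
  ext i j
  fin_cases i <;> fin_cases j <;>
    simp [toMatrix, Matrix.mul_apply, Fin.sum_univ_three]

theorem similar_swap_second_third (f : TernaryForm) :
    TernarySimilar f.toMatrix (toMatrix ⟨f.a, f.c, f.b, f.r, f.t, f.s⟩) := by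
  refine ⟨1, one_pos, !![1, 0, 0; 0, 0, 1; 0, 1, 0], by simp [Matrix.det_fin_three], ?_⟩
  ext i j
  fin_cases i <;> fin_cases j <;>
    simp [toMatrix, Matrix.mul_apply, Fin.sum_univ_three]

/-- Replace the first basis vector by `e₁ + y e₂ + z e₃`. -/
theorem similar_shear_first (f : TernaryForm) (y z : ℤ) :
    TernarySimilar f.toMatrix (toMatrix ⟨f.eval 1 y z, f.b, f.c, f.r,
      f.s + f.r * y + f.c * z, f.t + f.b * y + f.r * z⟩) := by
  refine ⟨1, one_pos, !![1, 0, 0; (y : ℚ), 1, 0; (z : ℚ), 0, 1],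
    by simp [Matrix.det_fin_three], ?_⟩
  ext i j
  fin_cases i <;> fin_cases j <;>
    simp [toMatrix, eval, Matrix.mul_apply, Fin.sum_univ_three] <;> ring

/-- Replace the second basis vector by `e₂ + z e₃`. -/
theorem similar_shear_second (f : TernaryForm) (z : ℤ) :
    TernarySimilar f.toMatrix (toMatrix ⟨f.a, f.eval 0 1 z, f.c, f.r + f.c * z, f.s,
      f.t + f.s * z⟩) := by
  refine ⟨1, one_pos, !![1, 0, 0; 0, 1, 0; 0, (z : ℚ), 1], by simp [Matrix.det_fin_three], ?_⟩
  ext i j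
  fin_cases i <;> fin_cases j <;>
    simp [toMatrix, eval, Matrix.mul_apply, Fin.sum_univ_three] <;> ring

/-- Divide the first basis vector by `q`. -/
theorem similar_div_first {q : ℤ} (hq : q ≠ 0) (a b c r s t : ℤ) :
    TernarySimilar (toMatrix ⟨q ^ 2 * a, b, c, r, q * s, q * t⟩)
      (toMatrix ⟨a, b, c, r, s, t⟩) := by
  have hq' : (q : ℚ) ≠ 0 := by exact_mod_cast hq
  refine ⟨1, one_pos, !![(q : ℚ)⁻¹, 0, 0; 0, 1, 0; 0, 0, 1],
    by simp [Matrix.det_fin_three, hq'], ?_⟩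
  ext i j
  fin_cases i <;> fin_cases j <;>
    simp [toMatrix, Matrix.mul_apply, Fin.sum_univ_three] <;> field_simp

/-- Multiply the third basis vector by `q` and divide the form by `q`. -/
theorem similar_div_form {q : ℤ} (hq : 0 < q) (a b c r s t : ℤ) :
    TernarySimilar (toMatrix ⟨q * a, q * b, c, r, s, q * t⟩)
      (toMatrix ⟨a, b, q * c, r, s, t⟩) := by
  have hq' : (0 : ℚ) < q := by exact_mod_cast hq
  have hq0 := hq'.ne'
  refine ⟨(q : ℚ)⁻¹, inv_pos.mpr hq', !![1, 0, 0; 0, 1, 0; 0, 0, (q : ℚ)],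
    by simp [Matrix.det_fin_three, hq0], ?_⟩
  ext i j
  fin_cases i <;> fin_cases j <;>
    simp [toMatrix, Matrix.mul_apply, Fin.sum_univ_three] <;> field_simp

/-- Choose `n` with `|an + t| ≤ a / 2`. Then `a² ≤ a(an² + 2tn + b) = (an + t)² + (ab - t²) ≤ a² / 4
+ (ab - t²)`. -/
theorem three_mul_sq_le {a b t : ℤ} (ha : 0 < a) (h : ∀ n : ℤ, a ≤ a * n ^ 2 + 2 * t * n + b) :
    3 * a ^ 2 ≤ 4 * (a * b - t ^ 2) := by
  obtain ⟨n, hn⟩ : ∃ n : ℤ, 4 * (a * n + t) ^ 2 ≤ a ^ 2 := by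
    refine ⟨-((2 * t + a) / (2 * a)), ?_⟩
    have h1 := Int.emod_add_mul_ediv (2 * t + a) (2 * a)
    have h2 := Int.emod_nonneg (2 * t + a) (show 2 * a ≠ 0 by omega)
    have h3 := Int.emod_lt_of_pos (2 * t + a) (show 0 < 2 * a by omega)
    set k := (2 * t + a) / (2 * a)
    have h4 : 2 * (a * -k + t) ≤ a := by linarith
    have h5 : -a ≤ 2 * (a * -k + t) := by linarith
    nlinarith
  have h1 := mul_le_mul_of_nonneg_left (h n) ha.le
  nlinarith

/-- Hermite reduction of positive definite ternary forms. -/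
theorem exists_reduced (f : TernaryForm) (ha : 0 < f.a) (hm : 0 < f.minor) (hd : 0 < f.det) :
    ∃ g : TernaryForm, TernarySimilar f.toMatrix g.toMatrix ∧ g.det = f.det ∧ 0 < g.a ∧
      0 < g.minor ∧ 3 * g.a ^ 2 ≤ 4 * g.minor ∧ 3 * g.minor ^ 2 ≤ 4 * (g.a * g.det) := by
  -- Two moves alternate: one lowers `a` and keeps the binary minor, the other lowers the minor and
  -- keeps `a`. When neither applies, `three_mul_sq_le` holds for the leading binary form and for
  -- the binary form of minors, whose discriminant is `a * det`.
  induction hN : (f.a + f.minor).toNat using Nat.strong_induction_on generalizing f with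
  | _ N ih =>
  by_cases h1 : ∃ n : ℤ, f.a * n ^ 2 + 2 * f.t * n + f.b < f.a
  · obtain ⟨n, hn⟩ := h1
    let g : TernaryForm := ⟨f.a * n ^ 2 + 2 * f.t * n + f.b, f.a, f.c, -f.s, n * f.s + f.r,
      -(n * f.a + f.t)⟩
    have hgm : g.minor = f.minor := by simp only [minor, g]; ring
    have hgd : g.det = f.det := by simp only [det, g]; ring
    have hga : 0 < g.a := by
      have : f.a * g.a = (f.a * n + f.t) ^ 2 + f.minor := by simp only [minor, g]; ring
      have h2 : 0 < f.a * g.a := by rw [this]; positivity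
      exact pos_of_mul_pos_right h2 ha.le
    have hsim : TernarySimilar f.toMatrix g.toMatrix := by
      refine ⟨1, one_pos, !![(n : ℚ), -1, 0; 1, 0, 0; 0, 0, 1],
        by simp [Matrix.det_fin_three], ?_⟩
      ext i j
      fin_cases i <;> fin_cases j <;>
        simp [toMatrix, g, Matrix.mul_apply, Fin.sum_univ_three] <;> ring
    have hga' : g.a < f.a := hn
    obtain ⟨k, hk, hkd, hk'⟩ := ih _ (by rw [← hN, hgm]; omega) g hga (by rwa [hgm])
      (by rwa [hgd]) rfl
    exact ⟨k, hsim.trans hk, hkd.trans hgd, hk'⟩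
  push Not at h1
  have hA := three_mul_sq_le ha h1
  by_cases h2 : ∃ n : ℤ, f.minor * n ^ 2 + 2 * (f.a * f.r - f.s * f.t) * n +
      (f.a * f.c - f.s ^ 2) < f.minor
  · obtain ⟨n, hn⟩ := h2
    let g : TernaryForm := ⟨f.a, f.b * n ^ 2 + 2 * f.r * n + f.c, f.b, -(n * f.b + f.r), -f.t,
      n * f.t + f.s⟩
    have hgm : g.minor = f.minor * n ^ 2 + 2 * (f.a * f.r - f.s * f.t) * n +
        (f.a * f.c - f.s ^ 2) := by simp only [minor, g]; ring
    have hgd : g.det = f.det := by simp only [det, g]; ring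
    have hgm0 : 0 < g.minor := by
      have : f.minor * g.minor = (f.minor * n + (f.a * f.r - f.s * f.t)) ^ 2 + f.a * f.det := by
        simp only [minor, det, g]; ring
      have h2 : 0 < f.minor * g.minor := by rw [this]; positivity
      exact pos_of_mul_pos_right h2 hm.le
    have hsim : TernarySimilar f.toMatrix g.toMatrix := by
      refine ⟨1, one_pos, !![1, 0, 0; 0, (n : ℚ), -1; 0, 1, 0],
        by simp [Matrix.det_fin_three], ?_⟩
      ext i j
      fin_cases i <;> fin_cases j <;>
        simp [toMatrix, g, Matrix.mul_apply, Fin.sum_univ_three] <;> ring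
    have hga' : g.a = f.a := rfl
    obtain ⟨k, hk, hkd, hk'⟩ := ih _ (by rw [← hN, hga']; omega) g ha hgm0
      (by rwa [hgd]) rfl
    exact ⟨k, hsim.trans hk, hkd.trans hgd, hk'⟩
  push Not at h2
  have hB := three_mul_sq_le hm h2
  refine ⟨f, ⟨1, one_pos, 1, by simp, by simp⟩, rfl, ha, hm, hA, hB.trans (le_of_eq ?_)⟩
  simp only [minor, det]
  ring

/-- Orthogonalization of a form with leading coefficient one. -/
theorem similar_diagonal (f : TernaryForm) (ha : f.a = 1) (hm : f.minor ≠ 0) :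
    TernarySimilar f.toMatrix
      (Matrix.diagonal ![1, (f.minor : ℚ), (f.det : ℚ) / f.minor]) := by
  have hm' : (f.minor : ℚ) ≠ 0 := by exact_mod_cast hm
  have hmv : (f.minor : ℚ) = f.b - f.t ^ 2 := by simp [minor, ha]
  have hb : (f.b : ℚ) = f.minor + f.t ^ 2 := by rw [hmv]; ring
  set e : ℚ := (f.r - f.s * f.t) / f.minor with he
  have he' : (f.r : ℚ) = e * f.minor + f.s * f.t := by
    rw [he]
    field_simp
    ring
  have hdet : (f.det : ℚ) / f.minor = f.c - f.s ^ 2 - e ^ 2 * f.minor := by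
    rw [div_eq_iff hm']
    simp only [det, ha]
    push_cast
    rw [he', hb]
    ring
  refine ⟨1, one_pos, !![1, -(f.t : ℚ), -f.s + f.t * e; 0, 1, -e; 0, 0, 1],
    by simp [Matrix.det_fin_three], ?_⟩
  rw [hdet]
  ext i j
  fin_cases i <;> fin_cases j <;>
    simp [toMatrix, Matrix.mul_apply, Fin.sum_univ_three, ha, he', hb] <;> ring

end TernaryForm

namespace TernaryForm

/-! ### Integral models of the norm form on pure quaternions -/

/-- The form `f` is an integral form similar to the norm form on the pure quaternions of
`(A, B)`. -/
def IsModel (A B : ℚ) (f : TernaryForm) : Prop :=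
  TernarySimilar (Matrix.diagonal ![-A, -B, A * B]) f.toMatrix

theorem exists_isModel {A B : ℚ} : ∃ f, IsModel A B f := by
  have hnum : ∀ C : ℚ, ∃ n d : ℤ, (d : ℚ) ≠ 0 ∧ (n : ℚ) = C * d := fun C =>
    ⟨C.num, C.den, by simp, by simp⟩
  obtain ⟨m, d, hd, hA⟩ := hnum A
  obtain ⟨n, e, he, hB⟩ := hnum B
  refine ⟨⟨-m * d, -n * e, m * d * (n * e), 0, 0, 0⟩,
    1, one_pos, !![(d : ℚ), 0, 0; 0, (e : ℚ), 0; 0, 0, (d : ℚ) * e],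
    by simp [Matrix.det_fin_three, hd, he], ?_⟩
  ext i j
  fin_cases i <;> fin_cases j <;>
    simp [toMatrix, Matrix.mul_apply, Fin.sum_univ_three, Matrix.diagonal, hA, hB,
      -mul_eq_mul_right_iff] <;> ring

theorem dotProduct_mulVec_toMatrix (f : TernaryForm) {K : Type*} [Field K] [Algebra ℚ K]
    (v : Fin 3 → K) :
    v ⬝ᵥ (f.toMatrix.map (algebraMap ℚ K)).mulVec v = f.eval (v 0) (v 1) (v 2) := by
  simp [toMatrix, eval, dotProduct, Matrix.mulVec, Fin.sum_univ_three]
  ring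

/-- Values of similar forms agree up to the change of variables and the similarity factor. -/
theorem dotProduct_mulVec_smul {K : Type*} [Field K] [Algebra ℚ K]
    (F M : Matrix (Fin 3) (Fin 3) ℚ) (c : ℚ) (v : Fin 3 → K) :
    v ⬝ᵥ ((c • (M.transpose * F * M)).map (algebraMap ℚ K)).mulVec v =
      algebraMap ℚ K c * ((M.map (algebraMap ℚ K)).mulVec v ⬝ᵥ
        (F.map (algebraMap ℚ K)).mulVec ((M.map (algebraMap ℚ K)).mulVec v)) := by
  have h : (c • (M.transpose * F * M)).map (algebraMap ℚ K) = algebraMap ℚ K c •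
      ((M.map (algebraMap ℚ K)).transpose * F.map (algebraMap ℚ K) * M.map (algebraMap ℚ K)) := by
    rw [← Matrix.transpose_map, ← Matrix.map_mul, ← Matrix.map_mul]
    ext i j
    simp only [Matrix.map_apply, Matrix.smul_apply, smul_eq_mul, map_mul]
  rw [h, Matrix.smul_mulVec, dotProduct_smul, smul_eq_mul, ← Matrix.mulVec_mulVec,
    ← Matrix.mulVec_mulVec, Matrix.dotProduct_mulVec, Matrix.vecMul_transpose]

section Positivity

variable {A B : ℚ} (hA : A < 0) (hB : B < 0) {f : TernaryForm} (hf : IsModel A B f)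
include hA hB hf

theorem IsModel.eval_pos {x y z : ℚ} (h : ¬ (x = 0 ∧ y = 0 ∧ z = 0)) : 0 < f.eval x y z := by
  obtain ⟨c, hc, M, hM, hf⟩ := hf
  have h1 := dotProduct_mulVec_toMatrix f (K := ℚ) ![x, y, z]
  rw [hf, dotProduct_mulVec_smul] at h1
  have hw : (M.map (algebraMap ℚ ℚ)).mulVec ![x, y, z] ≠ 0 := by
    intro h0
    apply hM
    rw [← Matrix.exists_mulVec_eq_zero_iff]
    refine ⟨![x, y, z], fun hv => h ?_, by simpa using h0⟩
    exact ⟨congrFun hv 0, congrFun hv 1, congrFun hv 2⟩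
  generalize (M.map (algebraMap ℚ ℚ)).mulVec ![x, y, z] = w at h1 hw
  have h2 : w ⬝ᵥ ((Matrix.diagonal ![-A, -B, A * B]).map (algebraMap ℚ ℚ)).mulVec w =
      -A * w 0 ^ 2 + -B * w 1 ^ 2 + A * B * w 2 ^ 2 := by
    simp [dotProduct, Matrix.mulVec, Fin.sum_univ_three, Matrix.diagonal]
    ring
  rw [h2] at h1
  have h3 : f.eval x y z = c * (-A * w 0 ^ 2 + -B * w 1 ^ 2 + A * B * w 2 ^ 2) := by
    simpa using h1.symm
  rw [h3]
  refine mul_pos hc ?_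
  have hAB := mul_pos_of_neg_of_neg hA hB
  have p0 : 0 ≤ -A * w 0 ^ 2 := mul_nonneg (by linarith) (sq_nonneg _)
  have p1 : 0 ≤ -B * w 1 ^ 2 := mul_nonneg (by linarith) (sq_nonneg _)
  have p2 : 0 ≤ A * B * w 2 ^ 2 := mul_nonneg hAB.le (sq_nonneg _)
  by_contra hn
  apply hw
  have e0 : -A * w 0 ^ 2 = 0 := by linarith
  have e1 : -B * w 1 ^ 2 = 0 := by linarith
  have e2 : A * B * w 2 ^ 2 = 0 := by linarith
  ext i
  fin_cases i
  · simpa [hA.ne] using e0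
  · simpa [hB.ne] using e1
  · simpa [hA.ne, hB.ne] using e2

theorem IsModel.a_pos : 0 < f.a := by
  have := hf.eval_pos hA hB (x := 1) (y := 0) (z := 0) (by simp)
  simpa [eval] using this

theorem IsModel.minor_pos : 0 < f.minor := by
  have ha := hf.a_pos hA hB
  have h1 := hf.eval_pos hA hB (x := -(f.t : ℚ)) (y := f.a) (z := 0)
    -- The vector `(-t, a, 0)` is orthogonal to the first basis vector, and its value is `a *
    -- minor`.
    (by simp [ha.ne'])
  have h2 : f.eval (-(f.t : ℚ)) f.a 0 = ((f.a * f.minor : ℤ) : ℚ) := by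
    simp only [eval, minor]
    push_cast
    ring
  rw [h2] at h1
  have h3 : 0 < f.a * f.minor := by exact_mod_cast h1
  exact pos_of_mul_pos_right h3 ha.le

theorem IsModel.det_pos : 0 < f.det := by
  obtain ⟨c, hc, M, hM, hf⟩ := hf
  have h := f.det_toMatrix
  rw [hf, Matrix.det_smul, Matrix.det_mul, Matrix.det_mul, Matrix.det_transpose] at h
  have hD : (Matrix.diagonal ![-A, -B, A * B]).det = (A * B) ^ 2 := by
    rw [Matrix.det_diagonal]
    simp [Fin.prod_univ_three]
    ring
  rw [hD] at h
  have hAB := mul_pos_of_neg_of_neg hA hB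
  have : (0 : ℚ) < f.det := by
    rw [← h]
    have := sq_pos_of_ne_zero hM
    have e : c ^ Fintype.card (Fin 3) * (M.det * (A * B) ^ 2 * M.det) =
      c ^ 3 * M.det ^ 2 * (A * B) ^ 2 := by simp; ring
    rw [e]
    positivity
  exact_mod_cast this

end Positivity

/-! ### Forms of minimal determinant -/

theorem exists_radical_vector (f : TernaryForm) {q : ℕ} [Fact q.Prime] (h : (q : ℤ) ∣ f.det) :
    ∃ x y z : ℤ, (x = 1 ∨ y = 1 ∨ z = 1) ∧ (q : ℤ) ∣ f.a * x + f.t * y + f.s * z ∧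
      (q : ℤ) ∣ f.t * x + f.b * y + f.r * z ∧ (q : ℤ) ∣ f.s * x + f.r * y + f.c * z := by
  let F : Matrix (Fin 3) (Fin 3) (ZMod q) :=
    !![(f.a : ZMod q), f.t, f.s; (f.t : ZMod q), f.b, f.r; (f.s : ZMod q), f.r, f.c]
  have hF : F.det = 0 := by
    rw [← ZMod.intCast_zmod_eq_zero_iff_dvd] at h
    rw [← h]
    simp [F, det, Matrix.det_fin_three]
    ring
  obtain ⟨v, hv0, hv⟩ := Matrix.exists_mulVec_eq_zero_iff.mpr hF
  obtain ⟨k, hk⟩ : ∃ k, v k ≠ 0 := by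
    by_contra! h0
    exact hv0 (funext h0)
  choose w hw using fun i => ZMod.intCast_surjective ((v k)⁻¹ * v i)
  have hrow : ∀ i, F i 0 * ((v k)⁻¹ * v 0) + F i 1 * ((v k)⁻¹ * v 1) +
      F i 2 * ((v k)⁻¹ * v 2) = 0 := by
    intro i
    have := congrFun hv i
    simp only [Matrix.mulVec, dotProduct, Fin.sum_univ_three, Pi.zero_apply] at this
    linear_combination (v k)⁻¹ * this
  -- The kernel vector is scaled to have `k`-th coordinate `1` modulo `q`, and the lift is made
  -- exactly `1` there, so that it extends to a basis of the lattice by a shear.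
  let u : Fin 3 → ℤ := fun i => if i = k then 1 else w i
  have hu : ∀ i, (u i : ZMod q) = (v k)⁻¹ * v i := by
    intro i
    by_cases hik : i = k
    · subst hik
      simp [u, hk]
    · simp [u, hik, hw]
  refine ⟨u 0, u 1, u 2, ?_, ?_, ?_, ?_⟩
  · fin_cases k <;> simp [u]
  · rw [← ZMod.intCast_zmod_eq_zero_iff_dvd]
    push_cast
    rw [hu, hu, hu]
    exact hrow 0
  · rw [← ZMod.intCast_zmod_eq_zero_iff_dvd]
    push_cast
    rw [hu, hu, hu]
    exact hrow 1
  · rw [← ZMod.intCast_zmod_eq_zero_iff_dvd]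
    push_cast
    rw [hu, hu, hu]
    exact hrow 2

/-- A basis whose first vector lies in the radical modulo `q`. -/
theorem exists_similar_radical_first (f : TernaryForm) {q : ℕ} [Fact q.Prime]
    (h : (q : ℤ) ∣ f.det) :
    ∃ g : TernaryForm, TernarySimilar f.toMatrix g.toMatrix ∧ g.det = f.det ∧
      (q : ℤ) ∣ g.a ∧ (q : ℤ) ∣ g.s ∧ (q : ℤ) ∣ g.t := by
  have key : ∀ (f : TernaryForm) (y z : ℤ), (q : ℤ) ∣ f.a + f.t * y + f.s * z →
      (q : ℤ) ∣ f.t + f.b * y + f.r * z → (q : ℤ) ∣ f.s + f.r * y + f.c * z →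
      ∃ g : TernaryForm, TernarySimilar f.toMatrix g.toMatrix ∧ g.det = f.det ∧
      (q : ℤ) ∣ g.a ∧ (q : ℤ) ∣ g.s ∧ (q : ℤ) ∣ g.t := by
    intro f y z h1 h2 h3
    refine ⟨_, f.similar_shear_first y z, ?_, ?_, h3, h2⟩
    · simp only [det, eval]
      push_cast
      ring
    · have : f.eval 1 y z = (f.a + f.t * y + f.s * z) + (f.t + f.b * y + f.r * z) * y +
          (f.s + f.r * y + f.c * z) * z := by
        simp only [eval]
        push_cast
        ring
      change (q : ℤ) ∣ f.eval 1 y z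
      rw [this]
      exact dvd_add (dvd_add h1 (h2.mul_right _)) (h3.mul_right _)
  obtain ⟨x, y, z, hxyz, h1, h2, h3⟩ := f.exists_radical_vector h
  rcases hxyz with rfl | rfl | rfl
  · exact key f y z (by simpa using h1) (by simpa using h2) (by simpa using h3)
  · obtain ⟨g, hg, hgd, hg'⟩ := key ⟨f.b, f.a, f.c, f.s, f.r, f.t⟩ x z
      (by convert h2 using 1; ring) (by convert h1 using 1; ring) (by convert h3 using 1; ring)
    refine ⟨g, f.similar_swap_first_second.trans hg, hgd.trans ?_, hg'⟩
    simp only [det]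
    ring
  · obtain ⟨g, hg, hgd, hg'⟩ := key ⟨f.c, f.b, f.a, f.t, f.s, f.r⟩ y x
      (by convert h3 using 1; ring) (by convert h2 using 1; ring) (by convert h1 using 1; ring)
    refine ⟨g, f.similar_swap_first_third.trans hg, hgd.trans ?_, hg'⟩
    simp only [det]
    ring

/-- The shape of a form at a prime `q` dividing its determinant when no similar integral form has
smaller determinant: `q x² ⊥ (anisotropic binary form)` modulo `q`. -/
structure IsRamifiedShape (q : ℕ) (f : TernaryForm) : Prop where
  dvd_a : (q : ℤ) ∣ f.a
  dvd_s : (q : ℤ) ∣ f.s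
  dvd_t : (q : ℤ) ∣ f.t
  not_sq_dvd : ¬ (q : ℤ) ^ 2 ∣ f.a
  anisotropic : ∀ y z : ℤ, (q : ℤ) ∣ f.eval 0 y z → (q : ℤ) ∣ y ∧ (q : ℤ) ∣ z

/-- A sublattice of index `q` on which the form is divisible by `q` lowers the determinant. -/
theorem exists_det_lt_of_dvd (f : TernaryForm) {q : ℕ} (hq : q.Prime) (hd : 0 < f.det)
    (ha : (q : ℤ) ∣ f.a) (hb : (q : ℤ) ∣ f.b) (ht : (q : ℤ) ∣ f.t) :
    ∃ g : TernaryForm, TernarySimilar f.toMatrix g.toMatrix ∧ g.det < f.det := by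
  have hq0 : (0 : ℤ) < q := by exact_mod_cast hq.pos
  have hq1 : (1 : ℤ) < q := by exact_mod_cast hq.one_lt
  obtain ⟨a, b, c, r, s, t⟩ := f
  obtain ⟨a, rfl⟩ := ha
  obtain ⟨b, rfl⟩ := hb
  obtain ⟨t, rfl⟩ := ht
  refine ⟨_, similar_div_form hq0 a b c r s t, ?_⟩
  have h1 : det ⟨q * a, q * b, c, r, s, q * t⟩ = q * det ⟨a, b, q * c, r, s, t⟩ := by
    simp only [det]
    ring
  rw [h1] at hd ⊢
  have := pos_of_mul_pos_right hd hq0.le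
  nlinarith

/-- Put a radical vector modulo `q` first in the basis. If `q²` divided its value, it could be
divided by `q`, lowering the determinant by `q²`. If the remaining binary form had a zero modulo
`q`, that zero could be made the second basis vector `e₂`, and on the lattice spanned by `e₁, e₂, q
e₃` the form would be divisible by `q`; dividing it out lowers the determinant by `q`. -/
theorem isRamifiedShape_of_minimal {f : TernaryForm} {q : ℕ} [Fact q.Prime]
    (hmin : ∀ g : TernaryForm, TernarySimilar f.toMatrix g.toMatrix → f.det ≤ g.det)
    (hd : 0 < f.det) (h : (q : ℤ) ∣ f.det) :
    ∃ g : TernaryForm, TernarySimilar f.toMatrix g.toMatrix ∧ g.det = f.det ∧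
      IsRamifiedShape q g := by
  have hq := Fact.out (p := q.Prime)
  have hq0 : (0 : ℤ) < q := by exact_mod_cast hq.pos
  have hq1 : (1 : ℤ) < q := by exact_mod_cast hq.one_lt
  have hprime : Prime (q : ℤ) := Nat.prime_iff_prime_int.mp hq
  obtain ⟨g, hfg, hgd, ha, hs, ht⟩ := f.exists_similar_radical_first h
  have hmin' : ∀ k : TernaryForm, TernarySimilar g.toMatrix k.toMatrix → g.det ≤ k.det :=
    fun k hk => hgd.le.trans (hmin k (hfg.trans hk))
  have hgd0 : 0 < g.det := hgd ▸ hd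
  refine ⟨g, hfg, hgd, ⟨ha, hs, ht, ?_, ?_⟩⟩
  · intro hsq
    clear ha
    obtain ⟨a, b, c, r, s, t⟩ := g
    obtain ⟨a, rfl⟩ := hsq
    obtain ⟨s, rfl⟩ := hs
    obtain ⟨t, rfl⟩ := ht
    have h1 := hmin' _ (similar_div_first hq0.ne' a b c r s t)
    have h2 : det ⟨q ^ 2 * a, b, c, r, q * s, q * t⟩ = q ^ 2 * det ⟨a, b, c, r, s, t⟩ := by
      simp only [det]
      ring
    rw [h2] at h1 hgd0
    have := pos_of_mul_pos_right hgd0 (by positivity)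
    have hq2 : (1 : ℤ) < q ^ 2 := by nlinarith
    nlinarith
  · -- an isotropic vector `(1, z)` modulo `q` contradicts minimality
    have key : ∀ k : TernaryForm, TernarySimilar g.toMatrix k.toMatrix → k.det = g.det →
        (q : ℤ) ∣ k.a → (q : ℤ) ∣ k.s → (q : ℤ) ∣ k.t → ∀ y z : ℤ, (q : ℤ) ∣ k.eval 0 y z →
        (q : ℤ) ∣ y := by
      intro k hgk hkd ha hs ht y z hyz
      by_contra hy
      obtain ⟨m, hm⟩ : ∃ m : ℤ, (q : ℤ) ∣ k.eval 0 1 m := by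
        have hy' : (y : ZMod q) ≠ 0 := by rwa [Ne, ZMod.intCast_zmod_eq_zero_iff_dvd]
        obtain ⟨m, hm⟩ := ZMod.intCast_surjective ((y : ZMod q)⁻¹ * (z : ZMod q))
        refine ⟨m, ?_⟩
        rw [← ZMod.intCast_zmod_eq_zero_iff_dvd] at hyz ⊢
        simp only [eval] at hyz ⊢
        push_cast at hyz ⊢
        rw [hm]
        have hone : (y : ZMod q)⁻¹ * y = 1 := inv_mul_cancel₀ hy'
        linear_combination (y : ZMod q)⁻¹ ^ 2 * hyz -
          ((k.b : ZMod q) * (1 + (y : ZMod q)⁻¹ * y) +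
            2 * (k.r : ZMod q) * ((y : ZMod q)⁻¹ * z)) * hone
      have hsh := k.similar_shear_second m
      have hshd : det ⟨k.a, k.eval 0 1 m, k.c, k.r + k.c * m, k.s, k.t + k.s * m⟩ = k.det := by
        simp only [det, eval]
        push_cast
        ring
      obtain ⟨l, hl, hld⟩ := exists_det_lt_of_dvd
        ⟨k.a, k.eval 0 1 m, k.c, k.r + k.c * m, k.s, k.t + k.s * m⟩ hq
        (by rw [hshd, hkd]; exact hgd0) ha hm (dvd_add ht (hs.mul_right m))
      have := hmin' l (hgk.trans (hsh.trans hl))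
      rw [hshd, hkd] at hld
      linarith
    intro y z hyz
    refine ⟨key g ⟨1, one_pos, 1, by simp, by simp⟩ rfl ha hs ht y z hyz, ?_⟩
    -- The other coordinate follows by exchanging the last two basis vectors.
    refine key _ g.similar_swap_second_third ?_ ha ht hs z y ?_
    · simp only [det]
      ring
    · convert hyz using 1
      simp only [eval]
      push_cast
      ring

/-! ### Local consequences of the ramified shape. -/

namespace IsRamifiedShape

/-- The cross term is even, so modulo `2` the binary form is the square of a linear form and has a
nontrivial zero. -/
theorem ne_two {f : TernaryForm} {q : ℕ} (h : IsRamifiedShape q f) : q ≠ 2 := by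
  rintro rfl
  rcases Int.even_or_odd f.b with hb | hb
  · have := h.anisotropic 1 0 (by simpa [eval] using hb.two_dvd)
    norm_num at this
  · rcases Int.even_or_odd f.c with hc | hc
    · have := h.anisotropic 0 1 (by simpa [eval] using hc.two_dvd)
      norm_num at this
    · have h2 : (2 : ℤ) ∣ f.b + f.c := (hb.add_odd hc).two_dvd
      have := h.anisotropic 1 1 (by
        have : f.eval 0 1 1 = f.b + f.c + 2 * f.r := by
          simp [eval]
        rw [this]
        exact dvd_add h2 (dvd_mul_right _ _))
      norm_num at this

/-- Modulo `q²` the determinant is `a(bc - r²)`. The factor `a` contains `q` only once, and `q ∣ bc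
- r²` would make the binary form degenerate, hence isotropic, modulo `q`. -/
theorem not_sq_dvd_det {f : TernaryForm} {q : ℕ} (hq : q.Prime) (h : IsRamifiedShape q f) :
    ¬ (q : ℤ) ^ 2 ∣ f.det := by
  intro hdet
  have hprime : Prime (q : ℤ) := Nat.prime_iff_prime_int.mp hq
  obtain ⟨s, hs⟩ := h.dvd_s
  obtain ⟨t, ht⟩ := h.dvd_t
  obtain ⟨a, ha⟩ := h.dvd_a
  have h1 : (q : ℤ) ^ 2 ∣ q * (a * (f.b * f.c - f.r ^ 2)) := by
    have e : (q : ℤ) * (a * (f.b * f.c - f.r ^ 2)) =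
        f.det - q ^ 2 * (2 * f.r * s * t - f.b * s ^ 2 - f.c * t ^ 2) := by
      simp only [det, ha, hs, ht]
      ring
    rw [e]
    exact dvd_sub hdet (dvd_mul_right _ _)
  rw [pow_two] at h1
  have h2 := (mul_dvd_mul_iff_left hprime.ne_zero).mp h1
  rcases hprime.dvd_or_dvd h2 with h3 | h3
  · apply h.not_sq_dvd
    rw [ha, pow_two]
    exact mul_dvd_mul_left _ h3
  · have h4 := h.anisotropic f.r (-f.b) (by
      have : f.eval 0 f.r (-f.b) = f.b * (f.b * f.c - f.r ^ 2) := by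
        simp only [eval]
        push_cast
        ring
      rw [this]
      exact h3.mul_left _)
    have h5 := (h.anisotropic 1 0 (by simpa [eval] using (dvd_neg.mp h4.2))).1
    exact hprime.not_isUnit (isUnit_of_dvd_one h5)

/-- A form of ramified shape has no primitive zero over the `q`-adic integers. -/
theorem eval_ne_zero {f : TernaryForm} {q : ℕ} [Fact q.Prime] (h : IsRamifiedShape q f)
    {w : Fin 3 → ℤ_[q]} (hw : ∃ k, w k = 1) : f.eval (w 0) (w 1) (w 2) ≠ 0 := by
  intro h0
  have hq := Fact.out (p := q.Prime)
  have hprime : Prime (q : ℤ_[q]) := PadicInt.prime_p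
  have hz : ∀ x : ℤ_[q], (q : ℤ_[q]) ∣ x ↔ PadicInt.toZMod x = 0 := by
    intro x
    rw [← RingHom.mem_ker, PadicInt.ker_toZMod, PadicInt.maximalIdeal_eq_span_p,
      Ideal.mem_span_singleton]
  have hintegral : ∀ k : ℤ, (q : ℤ) ∣ k ↔ (q : ℤ_[q]) ∣ k := by
    intro k
    rw [hz, map_intCast, ZMod.intCast_zmod_eq_zero_iff_dvd]
  have hcast : ∀ {k : ℤ}, (q : ℤ) ∣ k → ((k : ℤ) : ZMod q) = 0 := fun {k} hk =>
    (ZMod.intCast_zmod_eq_zero_iff_dvd k q).mpr hk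
  have hyz : (q : ℤ_[q]) ∣ w 1 ∧ (q : ℤ_[q]) ∣ w 2 := by
    obtain ⟨y, hy⟩ := ZMod.intCast_surjective (PadicInt.toZMod (w 1))
    obtain ⟨z, hz'⟩ := ZMod.intCast_surjective (PadicInt.toZMod (w 2))
    have h1 := congrArg PadicInt.toZMod h0
    simp only [eval, map_add, map_mul, map_pow, map_intCast, map_zero, map_ofNat,
      hcast h.dvd_a, hcast h.dvd_s, hcast h.dvd_t, ← hy, ← hz'] at h1
    have h2 := h.anisotropic y z (by
      rw [← ZMod.intCast_zmod_eq_zero_iff_dvd, ← h1]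
      simp only [eval]
      push_cast
      ring)
    rw [hz, hz, ← hy, ← hz', ZMod.intCast_zmod_eq_zero_iff_dvd, ZMod.intCast_zmod_eq_zero_iff_dvd]
    exact h2
  -- Once `q` divides `w 1` and `w 2`, every other term is divisible by `q²`; since `q²` does not
  -- divide `a`, also `q ∣ w 0`.
  have hx : (q : ℤ_[q]) ∣ w 0 := by
    obtain ⟨⟨y, hy⟩, ⟨z, hz'⟩⟩ := hyz
    obtain ⟨s, hs⟩ := h.dvd_s
    obtain ⟨t, ht⟩ := h.dvd_t
    obtain ⟨a, ha⟩ := h.dvd_a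
    have h1 : (q : ℤ_[q]) ^ 2 * (f.b * y ^ 2 + f.c * z ^ 2 + 2 * f.r * (y * z) +
        2 * s * (w 0 * z) + 2 * t * (w 0 * y)) + q * (a * w 0 ^ 2) = 0 := by
      rw [← h0]
      simp only [eval, hy, hz', ha, hs, ht]
      push_cast
      ring
    have h2 : (q : ℤ_[q]) * q ∣ q * (a * w 0 ^ 2) := by
      rw [← pow_two, eq_neg_of_add_eq_zero_right h1]
      exact (dvd_mul_right _ _).neg_right
    have h3 := (mul_dvd_mul_iff_left hprime.ne_zero).mp h2
    rcases hprime.dvd_or_dvd h3 with h4 | h4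
    · exfalso
      apply h.not_sq_dvd
      rw [ha, pow_two]
      exact mul_dvd_mul_left _ ((hintegral a).mpr h4)
    · exact hprime.dvd_of_dvd_pow h4
  obtain ⟨k, hk⟩ := hw
  have hall : (q : ℤ_[q]) ∣ w k := by
    fin_cases k
    · exact hx
    · exact hyz.1
    · exact hyz.2
  rw [hk] at hall
  exact hprime.not_isUnit (isUnit_of_dvd_one hall)

end IsRamifiedShape

end TernaryForm

/-! ### The quaternion algebras ramified at `{2, ∞}` and `{3, ∞}` -/

/-- If the norm form of a quaternion algebra is isotropic, so is its restriction to pure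
quaternions. -/
theorem exists_pure_zero_of_not_normAnisotropic {K : Type*} [Field K] {α β : K} (hα : α ≠ 0)
    (h : ¬ NormAnisotropic α β) :
    ∃ v : Fin 3 → K, v ≠ 0 ∧ -α * v 0 ^ 2 + -β * v 1 ^ 2 + α * β * v 2 ^ 2 = 0 := by
  unfold NormAnisotropic at h
  push Not at h
  obtain ⟨a, b, c, d, h0, hne⟩ := h
  by_cases hbc : α * b ^ 2 + β * c ^ 2 = 0
  · by_cases hz : b = 0 ∧ c = 0
    · obtain ⟨rfl, rfl⟩ := hz
      refine ⟨![a, d * α, 0], fun hv => ?_, ?_⟩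
      · have h1 : a = 0 := congrFun hv 0
        have h2 : d * α = 0 := congrFun hv 1
        exact hne h1 rfl rfl ((mul_eq_zero.mp h2).resolve_right hα)
      · simp
        linear_combination -α * h0
    · refine ⟨![b, c, 0], fun hv => hz ⟨congrFun hv 0, congrFun hv 1⟩, ?_⟩
      simp
      linear_combination -hbc
  · refine ⟨![β * (a * c - α * b * d), -α * (a * b + β * c * d), -(α * b ^ 2 + β * c ^ 2)],
      fun hv => hbc (neg_eq_zero.mp (congrFun hv 2)), ?_⟩
    simp
    linear_combination -(α * β * (α * b ^ 2 + β * c ^ 2)) * h0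

/-- Divide by a coordinate of largest norm. -/
theorem Padic.exists_primitive {l : ℕ} [Fact l.Prime] {v : Fin 3 → ℚ_[l]} (hv : v ≠ 0) :
    ∃ (c : ℚ_[l]) (w : Fin 3 → ℤ_[l]), (∀ k, (w k : ℚ_[l]) = c * v k) ∧ ∃ k, w k = 1 := by
  obtain ⟨m, hm⟩ := Finite.exists_max fun k => ‖v k‖
  have hm0 : v m ≠ 0 := by
    intro h0
    apply hv
    ext k
    have := hm k
    rw [h0, norm_zero] at this
    simpa using this
  have hle : ∀ k, ‖(v m)⁻¹ * v k‖ ≤ 1 := by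
    intro k
    rw [norm_mul, norm_inv, inv_mul_le_iff₀ (norm_pos_iff.mpr hm0), mul_one]
    exact hm k
  refine ⟨(v m)⁻¹, fun k => ⟨(v m)⁻¹ * v k, hle k⟩, fun k => rfl, m, ?_⟩
  apply Subtype.ext
  simp [hm0]

namespace TernaryForm

theorem eval_coe_padicInt (f : TernaryForm) {l : ℕ} [Fact l.Prime] (w : Fin 3 → ℤ_[l]) :
    ((f.eval (w 0) (w 1) (w 2) : ℤ_[l]) : ℚ_[l]) =
      f.eval (w 0 : ℚ_[l]) (w 1 : ℚ_[l]) (w 2 : ℚ_[l]) := by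
  have h2 : ((2 : ℤ_[l]) : ℚ_[l]) = 2 := rfl
  simp only [eval]
  push_cast
  rw [h2]

theorem eval_mul {R : Type*} [CommRing R] (f : TernaryForm) (c x y z : R) :
    f.eval (c * x) (c * y) (c * z) = c ^ 2 * f.eval x y z := by
  simp only [eval]
  ring

/-- At an unramified prime, an integral model has a primitive zero. -/
theorem IsModel.exists_primitive_zero {A B : ℚ} (hA : A ≠ 0) {f : TernaryForm}
    (hf : IsModel A B f) {l : ℕ} [Fact l.Prime]
    (hram : ¬ IsRamifiedOver ℚ_[l] (QuaternionAlgebra ℚ A 0 B)) :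
    ∃ w : Fin 3 → ℤ_[l], (∃ k, w k = 1) ∧ f.eval (w 0) (w 1) (w 2) = 0 := by
  rw [isRamifiedOver_iff_of_algEquiv AlgEquiv.refl] at hram
  obtain ⟨v, hv0, hv⟩ := exists_pure_zero_of_not_normAnisotropic
    (by simpa using hA) hram
  obtain ⟨c, hc, M, hM, hf⟩ := hf
  set Mk := M.map (algebraMap ℚ ℚ_[l]) with hMk
  have hdet : IsUnit Mk.det := by
    have : Mk.det = algebraMap ℚ ℚ_[l] M.det := by
      rw [hMk, RingHom.map_det]
      rfl
    rw [this, isUnit_iff_ne_zero]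
    simpa using hM
  set u := Mk⁻¹.mulVec v with hu
  have hMu : Mk.mulVec u = v := by
    rw [hu, Matrix.mulVec_mulVec, Matrix.mul_nonsing_inv _ hdet, Matrix.one_mulVec]
  have hu0 : u ≠ 0 := by
    intro h0
    rw [h0, Matrix.mulVec_zero] at hMu
    exact hv0 hMu.symm
  have heval : f.eval (u 0) (u 1) (u 2) = 0 := by
    rw [← dotProduct_mulVec_toMatrix f u, hf, dotProduct_mulVec_smul, ← hMk, hMu]
    have : v ⬝ᵥ ((Matrix.diagonal ![-A, -B, A * B]).map (algebraMap ℚ ℚ_[l])).mulVec v =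
        -algebraMap ℚ ℚ_[l] A * v 0 ^ 2 + -algebraMap ℚ ℚ_[l] B * v 1 ^ 2 +
          algebraMap ℚ ℚ_[l] A * algebraMap ℚ ℚ_[l] B * v 2 ^ 2 := by
      simp [dotProduct, Matrix.mulVec, Fin.sum_univ_three, Matrix.diagonal]
      ring
    rw [this, hv, mul_zero]
  obtain ⟨k, w, hw, hw1⟩ := Padic.exists_primitive hu0
  refine ⟨w, hw1, ?_⟩
  have h1 := f.eval_coe_padicInt w
  rw [hw, hw, hw, eval_mul, heval, mul_zero] at h1
  exact Subtype.ext h1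

section Minimal

variable {A B : ℚ} (hA : A < 0) (hB : B < 0)
include hA hB

theorem exists_minimal_isModel : ∃ f, IsModel A B f ∧
    ∀ g : TernaryForm, TernarySimilar f.toMatrix g.toMatrix → f.det ≤ g.det := by
  classical
  have hex : ∃ n : ℕ, ∃ f, IsModel A B f ∧ f.det.toNat = n := by
    obtain ⟨f, hf⟩ := exists_isModel (A := A) (B := B)
    exact ⟨_, f, hf, rfl⟩
  obtain ⟨f, hf, hfn⟩ := Nat.find_spec hex
  refine ⟨f, hf, fun g hg => ?_⟩
  have hg' : IsModel A B g := TernarySimilar.trans hf hg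
  have h1 := Nat.find_min' hex ⟨g, hg', rfl⟩
  rw [← hfn] at h1
  have h2 := hf.det_pos hA hB
  have h3 := hg'.det_pos hA hB
  omega

variable {p : ℕ}
  (hram : ∀ (l : ℕ) [Fact l.Prime], IsRamifiedOver ℚ_[l] (QuaternionAlgebra ℚ A 0 B) → l = p)
include hram

/-- The determinant of a minimal model divides the odd part of the discriminant. -/
theorem exists_isModel_det_dvd : ∃ f, IsModel A B f ∧
    ∀ q : ℕ, q.Prime → (q : ℤ) ∣ f.det → q = p ∧ q ≠ 2 ∧ ¬ (q : ℤ) ^ 2 ∣ f.det := by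
  obtain ⟨f, hf, hmin⟩ := exists_minimal_isModel hA hB
  refine ⟨f, hf, fun q hq hdvd => ?_⟩
  have : Fact q.Prime := ⟨hq⟩
  obtain ⟨g, hg, hgd, hshape⟩ := isRamifiedShape_of_minimal hmin (hf.det_pos hA hB) hdvd
  refine ⟨?_, hshape.ne_two, hgd ▸ hshape.not_sq_dvd_det hq⟩
  by_contra hqp
  have hg' : IsModel A B g := TernarySimilar.trans hf hg
  obtain ⟨w, hw, hw0⟩ := hg'.exists_primitive_zero hA.ne (fun h => hqp (hram q h))
  exact hshape.eval_ne_zero hw hw0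

end Minimal

/-- A reduced model of determinant at most three is diagonalizable in one of three ways. -/
theorem IsModel.similar_diagonal_of_det {A B : ℚ} (hA : A < 0) (hB : B < 0) {f : TernaryForm}
    (hf : IsModel A B f) (hdet : f.det = 1 ∨ f.det = 3) :
    (f.det = 1 ∧ TernarySimilar (Matrix.diagonal ![-A, -B, A * B]) (Matrix.diagonal ![1, 1, 1])) ∨
    (f.det = 3 ∧ TernarySimilar (Matrix.diagonal ![-A, -B, A * B]) (Matrix.diagonal ![1, 1, 3])) ∨
    (f.det = 3 ∧
      TernarySimilar (Matrix.diagonal ![-A, -B, A * B]) (Matrix.diagonal ![1, 2, 3 / 2])) := by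
  obtain ⟨g, hg, hgd, ha, hm, h1, h2⟩ :=
    f.exists_reduced (hf.a_pos hA hB) (hf.minor_pos hA hB) (hf.det_pos hA hB)
  have hga : g.a = 1 := by
    -- Combining the two reduction inequalities gives `27 a³ ≤ 64 det ≤ 192 < 27 · 8`, hence `a =
    -- 1`. What remains is `3 minor² ≤ 4 det`.
    have h3 : 27 * g.a ^ 4 ≤ 64 * (g.a * g.det) := by nlinarith
    have h4 : 27 * g.a ^ 3 ≤ 64 * g.det := by
      have : g.a * (27 * g.a ^ 3) ≤ g.a * (64 * g.det) := by linarith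
      exact le_of_mul_le_mul_left this ha
    have h5 : g.det ≤ 3 := by rcases hdet with h | h <;> simp [hgd, h]
    by_contra hne
    have h6 : 2 ≤ g.a := by omega
    have : 2 ^ 3 ≤ g.a ^ 3 := by gcongr
    linarith
  have hsim := TernarySimilar.trans hf (hg.trans (g.similar_diagonal hga hm.ne'))
  rw [hga, one_mul] at h2
  rw [hgd] at h2 hsim
  rcases hdet with hd | hd
  · rw [hd] at h2 hsim
    have hgm : g.minor = 1 := by
      by_contra hne
      have : 2 ≤ g.minor := by omega
      nlinarith
    rw [hgm] at hsim
    left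
    exact ⟨hd, by simpa using hsim⟩
  · rw [hd] at h2 hsim
    right
    have hgm : g.minor = 1 ∨ g.minor = 2 := by
      by_contra hne
      have : 3 ≤ g.minor := by omega
      nlinarith
    rcases hgm with hgm | hgm <;> rw [hgm] at hsim
    · left
      exact ⟨hd, by simpa using hsim⟩
    · right
      exact ⟨hd, by simpa using hsim⟩

theorem not_exists_primitive_zero_one_one_one {w : Fin 3 → ℤ_[2]} (hw : ∃ k, w k = 1) :
    eval ⟨1, 1, 1, 0, 0, 0⟩ (w 0) (w 1) (w 2) ≠ 0 := by
  intro h0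
  have h1 := congrArg (PadicInt.toZModPow (p := 2) 2) h0
  simp only [eval, map_add, map_mul, map_pow, map_intCast, map_zero, map_ofNat] at h1
  have key : ∀ x y z : ZMod (2 ^ 2), (x = 1 ∨ y = 1 ∨ z = 1) → x ^ 2 + y ^ 2 + z ^ 2 ≠ 0 := by
    decide
  refine key _ _ _ ?_ (by simpa using h1)
  obtain ⟨k, hk⟩ := hw
  fin_cases k
  · exact Or.inl (by rw [show w 0 = 1 from hk, map_one])
  · exact Or.inr (Or.inl (by rw [show w 1 = 1 from hk, map_one]))
  · exact Or.inr (Or.inr (by rw [show w 2 = 1 from hk, map_one]))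

theorem not_exists_primitive_zero_one_two_six {w : Fin 3 → ℤ_[2]} (hw : ∃ k, w k = 1) :
    eval ⟨1, 2, 6, 0, 0, 0⟩ (w 0) (w 1) (w 2) ≠ 0 := by
  intro h0
  have h1 := congrArg (PadicInt.toZModPow (p := 2) 4) h0
  simp only [eval, map_add, map_mul, map_pow, map_intCast, map_zero, map_ofNat] at h1
  have key : ∀ x y : ZMod (2 ^ 4), 1 + 2 * x ^ 2 + 6 * y ^ 2 ≠ 0 ∧ x ^ 2 + 2 + 6 * y ^ 2 ≠ 0 ∧
      x ^ 2 + 2 * y ^ 2 + 6 ≠ 0 := by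
    decide +kernel
  obtain ⟨k, hk⟩ := hw
  fin_cases k
  · refine (key (PadicInt.toZModPow 4 (w 1)) (PadicInt.toZModPow 4 (w 2))).1 ?_
    rw [show w 0 = 1 from hk, map_one] at h1
    simpa using h1
  · refine (key (PadicInt.toZModPow 4 (w 0)) (PadicInt.toZModPow 4 (w 2))).2.1 ?_
    rw [show w 1 = 1 from hk, map_one] at h1
    simpa using h1
  · refine (key (PadicInt.toZModPow 4 (w 0)) (PadicInt.toZModPow 4 (w 1))).2.2 ?_
    rw [show w 2 = 1 from hk, map_one] at h1
    simpa using h1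

end TernaryForm

/-- Pure quaternions from a diagonalization of the norm form. -/
theorem TernarySimilar.exists_quaternions {A B d₀ d₁ d₂ : ℚ} (hA : A < 0) (hB : B < 0)
    (h : TernarySimilar (Matrix.diagonal ![-A, -B, A * B]) (Matrix.diagonal ![d₀, d₁, d₂])) :
    ∃ (c ρ : ℚ) (e₀ e₁ e₂ : QuaternionAlgebra ℚ A 0 B), c ≠ 0 ∧ c = d₀ * d₁ * d₂ * ρ ^ 2 ∧
      e₀ * e₀ = (-(d₀ / c)) • 1 ∧ e₁ * e₁ = (-(d₁ / c)) • 1 ∧ e₂ * e₂ = (-(d₂ / c)) • 1 ∧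
      e₁ * e₀ = -(e₀ * e₁) ∧ e₀ * e₂ = -(e₂ * e₀) := by
  obtain ⟨c, hc, M, hM, hdiag⟩ := h
  have hc0 := hc.ne'
  have hdet := congrArg Matrix.det hdiag
  rw [Matrix.det_smul, Matrix.det_mul, Matrix.det_mul, Matrix.det_transpose, Matrix.det_diagonal,
    Matrix.det_diagonal] at hdet
  simp only [Fin.prod_univ_three, Fintype.card_fin, Matrix.cons_val_zero, Matrix.cons_val_one,
    Matrix.cons_val] at hdet
  have entry : ∀ k l : Fin 3, (Matrix.diagonal ![d₀, d₁, d₂]) k l = c * (-A * (M 0 k * M 0 l) +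
      -B * (M 1 k * M 1 l) + A * B * (M 2 k * M 2 l)) := by
    intro k l
    rw [hdiag]
    simp [Matrix.mul_apply, Fin.sum_univ_three, Matrix.diagonal, -mul_eq_mul_left_iff]
    ring
  have h00 : d₀ = _ := entry 0 0
  have h11 : d₁ = _ := entry 1 1
  have h22 : d₂ = _ := entry 2 2
  have h01 : -A * (M 0 0 * M 0 1) + -B * (M 1 0 * M 1 1) + A * B * (M 2 0 * M 2 1) = 0 :=
    (mul_eq_zero.mp (entry 0 1).symm).resolve_left hc0
  have h02 : -A * (M 0 0 * M 0 2) + -B * (M 1 0 * M 1 2) + A * B * (M 2 0 * M 2 2) = 0 :=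
    (mul_eq_zero.mp (entry 0 2).symm).resolve_left hc0
  -- The quaternions are the columns of `M`; orthogonal pure quaternions anticommute. Determinants
  -- give `d₀ d₁ d₂ = c³ (det M)² (AB)²`, which fixes the similarity factor `c` up to squares
  -- because the dimension is odd.
  refine ⟨c, (c * M.det * (A * B))⁻¹, ⟨0, M 0 0, M 1 0, M 2 0⟩, ⟨0, M 0 1, M 1 1, M 2 1⟩,
    ⟨0, M 0 2, M 1 2, M 2 2⟩, hc0, ?_, ?_, ?_, ?_, ?_, ?_⟩
  · have hA0 := hA.ne
    have hB0 := hB.ne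
    rw [hdet]
    field_simp
  · rw [h00]
    ext <;> simp <;> field_simp <;> ring
  · rw [h11]
    ext <;> simp <;> field_simp <;> ring
  · rw [h22]
    ext <;> simp <;> field_simp <;> ring
  · ext <;> simp <;> first | linear_combination (-2 : ℚ) * h01 | ring
  · ext <;> simp <;> first | linear_combination (-2 : ℚ) * h02 | ring

theorem exists_quaternions_of_ramified_two {A B : ℚ} (hA : A < 0) (hB : B < 0)
    (hram : ∀ (l : ℕ) [Fact l.Prime], IsRamifiedOver ℚ_[l] (QuaternionAlgebra ℚ A 0 B) → l = 2) :
    ∃ i j : QuaternionAlgebra ℚ A 0 B, i * i = -1 ∧ j * j = -1 ∧ j * i = -(i * j) := by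
  obtain ⟨f, hf, hprimes⟩ := TernaryForm.exists_isModel_det_dvd hA hB hram
  have hd := hf.det_pos hA hB
  have hd1 : f.det = 1 := by
    by_contra hne
    obtain ⟨q, hq, hdvd⟩ := Nat.exists_prime_and_dvd (n := f.det.natAbs) (by omega)
    obtain ⟨h1, h2, -⟩ := hprimes q hq (Int.natCast_dvd.mpr hdvd)
    exact h2 h1
  have hsim : TernarySimilar (Matrix.diagonal ![-A, -B, A * B]) (Matrix.diagonal ![1, 1, 1]) := by
    rcases hf.similar_diagonal_of_det hA hB (Or.inl hd1) with ⟨-, h⟩ | ⟨h3, -⟩ | ⟨h3, -⟩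
    · exact h
    · omega
    · omega
  obtain ⟨c, ρ, e₀, e₁, e₂, hc0, hc, h0, h1, -, h01, -⟩ := hsim.exists_quaternions hA hB
  refine ⟨ρ • e₀, ρ • e₁, ?_, ?_, ?_⟩
  · rw [smul_mul_smul_comm, h0, smul_smul, ← neg_one_smul ℚ (1 : QuaternionAlgebra ℚ A 0 B)]
    congr 1
    field_simp
    linear_combination hc
  · rw [smul_mul_smul_comm, h1, smul_smul, ← neg_one_smul ℚ (1 : QuaternionAlgebra ℚ A 0 B)]
    congr 1
    field_simp
    linear_combination hc
  · rw [smul_mul_smul_comm, smul_mul_smul_comm, h01, smul_neg]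

/-- The algebra is split at `2`, whereas the diagonal forms `(1, 1, 1)` and `(1, 2, 3/2)` are
anisotropic there; only `(1, 1, 3)` survives. -/
theorem exists_quaternions_of_ramified_three {A B : ℚ} (hA : A < 0) (hB : B < 0)
    (hram : ∀ (l : ℕ) [Fact l.Prime], IsRamifiedOver ℚ_[l] (QuaternionAlgebra ℚ A 0 B) → l = 3) :
    ∃ i j : QuaternionAlgebra ℚ A 0 B, i * i = -1 ∧ j * j = (-3 : ℚ) • 1 ∧ j * i = -(i * j) := by
  obtain ⟨f, hf, hprimes⟩ := TernaryForm.exists_isModel_det_dvd hA hB hram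
  have hd := hf.det_pos hA hB
  have hd3 : f.det = 1 ∨ f.det = 3 := by
    by_contra! hne
    by_cases h3 : (3 : ℤ) ∣ f.det
    · obtain ⟨m, hm⟩ := h3
      have hnot := (hprimes 3 Nat.prime_three (by rw [hm]; exact dvd_mul_right _ _)).2.2
      obtain ⟨q, hq, hdvd⟩ := Nat.exists_prime_and_dvd (n := m.natAbs) (by omega)
      have hdvd' : (q : ℤ) ∣ m := Int.natCast_dvd.mpr hdvd
      obtain ⟨h1, -, -⟩ := hprimes q hq (by rw [hm]; exact hdvd'.mul_left _)
      subst h1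
      apply hnot
      rw [hm, pow_two]
      exact mul_dvd_mul_left _ hdvd'
    · obtain ⟨q, hq, hdvd⟩ := Nat.exists_prime_and_dvd (n := f.det.natAbs) (by omega)
      have hdvd' : (q : ℤ) ∣ f.det := Int.natCast_dvd.mpr hdvd
      obtain ⟨h1, -, -⟩ := hprimes q hq hdvd'
      subst h1
      exact h3 hdvd'
  have hnot2 : ¬ IsRamifiedOver ℚ_[2] (QuaternionAlgebra ℚ A 0 B) := fun h => by
    have := hram 2 h
    norm_num at this
  have hsim : TernarySimilar (Matrix.diagonal ![-A, -B, A * B]) (Matrix.diagonal ![1, 1, 3]) := by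
    rcases hf.similar_diagonal_of_det hA hB hd3 with ⟨-, h⟩ | ⟨-, h⟩ | ⟨-, h⟩
    · exfalso
      have hg : TernaryForm.IsModel A B ⟨1, 1, 1, 0, 0, 0⟩ := by
        have e : TernaryForm.toMatrix ⟨1, 1, 1, 0, 0, 0⟩ = Matrix.diagonal ![1, 1, 1] := by
          ext i j
          fin_cases i <;> fin_cases j <;> simp [TernaryForm.toMatrix]
        rw [TernaryForm.IsModel, e]
        exact h
      obtain ⟨w, hw, hw0⟩ := hg.exists_primitive_zero hA.ne hnot2
      exact TernaryForm.not_exists_primitive_zero_one_one_one hw hw0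
    · exact h
    · exfalso
      have hg : TernaryForm.IsModel A B ⟨1, 2, 6, 0, 0, 0⟩ := by
        refine TernarySimilar.trans h ⟨1, one_pos, !![1, 0, 0; 0, 1, 0; 0, 0, 2],
          by simp [Matrix.det_fin_three], ?_⟩
        ext i j
        fin_cases i <;> fin_cases j <;>
          simp [TernaryForm.toMatrix, Matrix.mul_apply, Fin.sum_univ_three, Matrix.diagonal]
        norm_num
      obtain ⟨w, hw, hw0⟩ := hg.exists_primitive_zero hA.ne hnot2
      exact TernaryForm.not_exists_primitive_zero_one_two_six hw hw0
  obtain ⟨c, ρ, e₀, e₁, e₂, hc0, hc, h0, -, h2, -, h02⟩ := hsim.exists_quaternions hA hB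
  -- Here `c = 3ρ²`, so `e₂² = -1/ρ²` and `e₀² = -1/(3ρ²)`.
  refine ⟨ρ • e₂, (3 * ρ) • e₀, ?_, ?_, ?_⟩
  · rw [smul_mul_smul_comm, h2, smul_smul, ← neg_one_smul ℚ (1 : QuaternionAlgebra ℚ A 0 B)]
    congr 1
    field_simp
    linear_combination hc
  · rw [smul_mul_smul_comm, h0, smul_smul]
    congr 1
    field_simp
    linear_combination hc
  · rw [smul_mul_smul_comm, smul_mul_smul_comm, h02, smul_neg, mul_comm]

/-! ### Unit groups of small quaternion orders -/

/-- Generators `x` (of order three) and `y` (of order four) of a quaternion order, with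
`tr (x y) = u`. -/
structure IsOrderPair {R : Type*} [Ring R] (x y : R) (u : ℤ) : Prop where
  x_mul_x : x * x = -1 - x
  y_mul_y : y * y = -1
  y_mul_x : y * x = u • 1 - y - x * y

namespace IsOrderPair

/-- The norm form of the order generated by `x` and `y` in the basis `1, x, y, x y`. -/
def norm (u a b c d : ℤ) : ℤ :=
  a ^ 2 - a * b + b ^ 2 + c ^ 2 - c * d + d ^ 2 + u * (a * d - b * c)

variable {R : Type*} [Ring R]

/-- The element with coordinates `a, b, c, d` in the basis `1, x, y, x y`. -/
def elt (x y : R) (a b c d : ℤ) : R := a • 1 + b • x + c • y + d • (x * y)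

variable {x y : R} {u : ℤ} (h : IsOrderPair x y u)
include h

theorem elt_mul_elt (a b c d a' b' c' d' : ℤ) :
    elt x y a b c d * elt x y a' b' c' d' = elt x y
      (a * a' - b * b' + u * c * b' - c * c' + c * d' - d * d')
      (a * b' + b * a' - b * b' + c * d' + u * d * b' - d * c')
      (a * c' + c * a' - b * d' - c * b' + u * c * d' + d * b')
      (a * d' + d * a' + b * c' - b * d' - c * b' + u * d * d') := by
  have h1 : x * (x * y) = -y - x * y := by
    rw [← mul_assoc, h.x_mul_x, sub_mul, neg_mul, one_mul]
  have h2 : y * (x * y) = 1 + x + u • y := by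
    rw [← mul_assoc, h.y_mul_x, sub_mul, sub_mul, mul_assoc, h.y_mul_y, smul_mul_assoc, one_mul]
    simp only [mul_neg, mul_one]
    abel
  have h3 : x * y * x = u • x + y := by
    rw [mul_assoc, h.y_mul_x, mul_sub, mul_sub, h1, mul_smul_comm, mul_one]
    abel
  have h4 : x * y * y = -x := by
    rw [mul_assoc, h.y_mul_y, mul_neg, mul_one]
  have h5 : x * y * (x * y) = -1 + u • (x * y) := by
    rw [mul_assoc, h2, mul_add, mul_add, h.x_mul_x, mul_one, mul_smul_comm]
    abel
  simp only [elt, mul_add, add_mul, smul_mul_assoc, mul_smul_comm, one_mul, mul_one, h1, h2, h3,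
    h4, h5, h.x_mul_x, h.y_mul_y, h.y_mul_x]
  module

theorem elt_mul_conj (a b c d : ℤ) :
    elt x y a b c d * elt x y (a - b + u * d) (-b) (-c) (-d) = norm u a b c d • 1 := by
  rw [h.elt_mul_elt]
  simp only [elt, norm]
  module

theorem conj_mul_elt (a b c d : ℤ) :
    elt x y (a - b + u * d) (-b) (-c) (-d) * elt x y a b c d = norm u a b c d • 1 := by
  rw [h.elt_mul_elt]
  simp only [elt, norm]
  module

/-- The unit with given coordinates. -/
def unit (a b c d : ℤ) (hn : norm u a b c d = 1) : Rˣ :=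
  ⟨elt x y a b c d, elt x y (a - b + u * d) (-b) (-c) (-d),
    by rw [h.elt_mul_conj, hn, one_smul], by rw [h.conj_mul_elt, hn, one_smul]⟩

/-- The group of norm-one elements of the order generated by `x` and `y`. -/
def units : Subgroup Rˣ where
  carrier := {g | ∃ a b c d : ℤ, norm u a b c d = 1 ∧ (g : R) = elt x y a b c d}
  mul_mem' := by
    rintro g g' ⟨a, b, c, d, hn, hg⟩ ⟨a', b', c', d', hn', hg'⟩
    refine ⟨_, _, _, _, ?_, by rw [Units.val_mul, hg, hg', h.elt_mul_elt]⟩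
    rw [← one_mul (1 : ℤ)]
    nth_rw 1 [← hn]
    rw [← hn']
    simp only [norm]
    ring
  one_mem' := ⟨1, 0, 0, 0, by simp [norm], by simp [elt]⟩
  inv_mem' := by
    rintro g ⟨a, b, c, d, hn, hg⟩
    refine ⟨a - b + u * d, -b, -c, -d, ?_, ?_⟩
    · rw [← hn]
      simp only [norm]
      ring
    · refine Units.inv_eq_of_mul_eq_one_right ?_
      rw [hg, h.elt_mul_conj, hn, one_smul]

theorem unit_mem (a b c d : ℤ) (hn : norm u a b c d = 1) : h.unit a b c d hn ∈ h.units :=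
  ⟨a, b, c, d, hn, rfl⟩

omit h in
theorem abs_le_two_of_norm_eq_one (hu : u = 0 ∨ u = -1) {a b c d : ℤ}
    (hn : norm u a b c d = 1) : |a| ≤ 2 ∧ |b| ≤ 2 ∧ |c| ≤ 2 ∧ |d| ≤ 2 := by
  have hsq : ∀ k : ℤ, k ^ 2 ≤ 4 → |k| ≤ 2 := fun k hk => abs_le_of_sq_le_sq (by linarith) (by norm_num)
  rcases hu with rfl | rfl
  -- In both cases four times the norm is written as a positive combination of squares, which bounds
  -- the coordinates.
  · have h4 : (2 * a - b) ^ 2 + 3 * b ^ 2 + (2 * c - d) ^ 2 + 3 * d ^ 2 = 4 := by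
      rw [← mul_one (4 : ℤ), ← hn, norm]
      ring
    refine ⟨hsq _ ?_, hsq _ ?_, hsq _ ?_, hsq _ ?_⟩ <;>
      nlinarith [sq_nonneg (2 * a - b), sq_nonneg (2 * c - d), sq_nonneg b, sq_nonneg d,
        sq_nonneg (a - 2 * b), sq_nonneg (c - 2 * d), sq_nonneg a, sq_nonneg c]
  · have h4 : (2 * a - b - d) ^ 2 + (b + 2 * c - d) ^ 2 + (b + d) ^ 2 + (b - d) ^ 2 = 4 := by
      rw [← mul_one (4 : ℤ), ← hn, norm]
      ring
    refine ⟨hsq _ ?_, hsq _ ?_, hsq _ ?_, hsq _ ?_⟩ <;>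
      nlinarith [sq_nonneg (2 * a - b - d), sq_nonneg (b + 2 * c - d), sq_nonneg (b + d),
        sq_nonneg (b - d), sq_nonneg (2 * a - b - d - (b + d)), sq_nonneg (b + 2 * c - d - (d - b))]

theorem finite_units (hu : u = 0 ∨ u = -1) : Finite h.units := by
  let S : Set (ℤ × ℤ × ℤ × ℤ) :=
    Set.Icc (-2) 2 ×ˢ Set.Icc (-2) 2 ×ˢ Set.Icc (-2) 2 ×ˢ Set.Icc (-2) 2
  have hS : S.Finite := (Set.finite_Icc _ _).prod ((Set.finite_Icc _ _).prod
    ((Set.finite_Icc _ _).prod (Set.finite_Icc _ _)))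
  have hfin : ((fun g : Rˣ => (g : R)) ⁻¹'
      ((fun v : ℤ × ℤ × ℤ × ℤ => elt x y v.1 v.2.1 v.2.2.1 v.2.2.2) '' S)).Finite :=
    (hS.image _).preimage Units.val_injective.injOn
  refine Set.Finite.subset hfin ?_
  rintro g ⟨a, b, c, d, hn, hg⟩
  obtain ⟨ha, hb, hc, hd⟩ := abs_le_two_of_norm_eq_one hu hn
  exact ⟨(a, b, c, d), ⟨abs_le.mp ha, abs_le.mp hb, abs_le.mp hc, abs_le.mp hd⟩, hg.symm⟩

end IsOrderPair

/-! ### Lower bounds for the Jordan constant -/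

section Hurwitz

/-- The pair `ω = (-1 + i + j + k)/2` and `i` generates the Hurwitz order. -/
theorem isOrderPair_hurwitz : IsOrderPair
    (⟨-1 / 2, 1 / 2, 1 / 2, 1 / 2⟩ : QuaternionAlgebra ℚ (-1) 0 (-1)) ⟨0, 1, 0, 0⟩ (-1) := by
  constructor <;> ext <;> simp <;> norm_num

theorem elt_hurwitz (a b c d : ℤ) :
    IsOrderPair.elt (⟨-1 / 2, 1 / 2, 1 / 2, 1 / 2⟩ : QuaternionAlgebra ℚ (-1) 0 (-1))
      ⟨0, 1, 0, 0⟩ a b c d =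
      ⟨a - b / 2 - d / 2, b / 2 + c - d / 2, b / 2 + d / 2, b / 2 - d / 2⟩ := by
  ext <;> simp [IsOrderPair.elt] <;> ring

theorem card_units_hurwitz_ge : 24 ≤ Nat.card isOrderPair_hurwitz.units := by
  have := isOrderPair_hurwitz.finite_units (Or.inr rfl)
  let I : Finset ℤ := Finset.Icc (-2) 2
  let S : Finset (ℤ × ℤ × ℤ × ℤ) := (I ×ˢ I ×ˢ I ×ˢ I).filter
    fun v => IsOrderPair.norm (-1) v.1 v.2.1 v.2.2.1 v.2.2.2 = 1
  have hS : S.card = 24 := by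
    decide +kernel
  let φ : S → isOrderPair_hurwitz.units := fun v =>
    ⟨_, isOrderPair_hurwitz.unit_mem v.1.1 v.1.2.1 v.1.2.2.1 v.1.2.2.2
      (Finset.mem_filter.mp v.2).2⟩
  have hφ : Function.Injective φ := by
    rintro ⟨⟨a, b, c, d⟩, hv⟩ ⟨⟨a', b', c', d'⟩, hv'⟩ heq
    have h1 : IsOrderPair.elt _ _ a b c d = IsOrderPair.elt _ _ a' b' c' d' :=
      congrArg (fun g : isOrderPair_hurwitz.units => (g.1 : QuaternionAlgebra ℚ (-1) 0 (-1))) heq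
    rw [elt_hurwitz, elt_hurwitz, QuaternionAlgebra.ext_iff] at h1
    obtain ⟨e1, e2, e3, e4⟩ := h1
    simp only at e1 e2 e3 e4
    have hb : (b : ℚ) = b' := by linarith
    have hd : (d : ℚ) = d' := by linarith
    have ha : (a : ℚ) = a' := by linarith
    have hc : (c : ℚ) = c' := by linarith
    have hb' : b = b' := by exact_mod_cast hb
    have hd' : d = d' := by exact_mod_cast hd
    have ha' : a = a' := by exact_mod_cast ha
    have hc' : c = c' := by exact_mod_cast hc
    subst hb' hd' ha' hc'
    rfl
  have := Nat.card_le_card_of_injective φ hφ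
  rwa [Nat.card_eq_fintype_card, Fintype.card_coe, hS] at this

/-- Two quaternions commute exactly when their pure parts are parallel. Conjugation by `i` or `j`
changes the signs of two of the coordinates `b, c, d`, which forces the products `bc, bd, cd` to
vanish. Conjugation by `ω` permutes them cyclically, which equates the squares with these products.
-/
theorem im_eq_zero_of_commute_conj {v : QuaternionAlgebra ℚ (-1) 0 (-1)}
    (hi : (⟨0, 1, 0, 0⟩ : QuaternionAlgebra ℚ (-1) 0 (-1)) * v * star ⟨0, 1, 0, 0⟩ * v =
      v * (⟨0, 1, 0, 0⟩ * v * star ⟨0, 1, 0, 0⟩))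
    (hj : (⟨0, 0, 1, 0⟩ : QuaternionAlgebra ℚ (-1) 0 (-1)) * v * star ⟨0, 0, 1, 0⟩ * v =
      v * (⟨0, 0, 1, 0⟩ * v * star ⟨0, 0, 1, 0⟩))
    (hω : (⟨-1 / 2, 1 / 2, 1 / 2, 1 / 2⟩ : QuaternionAlgebra ℚ (-1) 0 (-1)) * v *
        star ⟨-1 / 2, 1 / 2, 1 / 2, 1 / 2⟩ * v =
      v * (⟨-1 / 2, 1 / 2, 1 / 2, 1 / 2⟩ * v * star ⟨-1 / 2, 1 / 2, 1 / 2, 1 / 2⟩)) :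
    v.imI = 0 ∧ v.imJ = 0 ∧ v.imK = 0 := by
  obtain ⟨r, b, c, d⟩ := v
  simp only [QuaternionAlgebra.star_mk, QuaternionAlgebra.mk_mul_mk,
    QuaternionAlgebra.mk.injEq] at hi hj hω
  obtain ⟨-, -, i3, i4⟩ := hi
  obtain ⟨-, j2, -, -⟩ := hj
  obtain ⟨-, o2, o3, o4⟩ := hω
  ring_nf at i3 i4 j2 o2 o3 o4
  have hbd : b * d = 0 := by linarith
  have hbc : b * c = 0 := by linarith
  have hcd : c * d = 0 := by linarith
  refine ⟨?_, ?_, ?_⟩ <;> rw [← pow_eq_zero_iff two_ne_zero] <;> linarith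

/-- A normal abelian subgroup of the Hurwitz units is central. -/
theorem coe_eq_one_or_neg_one_of_mem_normal {N : Subgroup isOrderPair_hurwitz.units}
    (hN : N.Normal) (hcomm : ∀ x ∈ N, ∀ y ∈ N, x * y = y * x) {g : isOrderPair_hurwitz.units}
    (hg : g ∈ N) : (g.1 : QuaternionAlgebra ℚ (-1) 0 (-1)) = 1 ∨
      (g.1 : QuaternionAlgebra ℚ (-1) 0 (-1)) = -1 := by
  set v : QuaternionAlgebra ℚ (-1) 0 (-1) := (g.1 : QuaternionAlgebra ℚ (-1) 0 (-1)) with hv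
  have hnorm : v.re ^ 2 + v.imI ^ 2 + v.imJ ^ 2 + v.imK ^ 2 = 1 := by
    obtain ⟨a, b, c, d, hn, he⟩ := g.2
    rw [hv, he, elt_hurwitz]
    have : ((IsOrderPair.norm (-1) a b c d : ℤ) : ℚ) = 1 := by exact_mod_cast hn
    rw [← this, IsOrderPair.norm]
    push_cast
    ring
  have hconj : ∀ (a b c d : ℤ), IsOrderPair.norm (-1) a b c d = 1 →
      ∀ m : QuaternionAlgebra ℚ (-1) 0 (-1),
      m = ⟨a - b / 2 - d / 2, b / 2 + c - d / 2, b / 2 + d / 2, b / 2 - d / 2⟩ →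
      m * v * star m * v = v * (m * v * star m) := by
    intro a b c d hn m hm
    have h1 := hcomm _ (hN.conj_mem g hg ⟨_, isOrderPair_hurwitz.unit_mem a b c d hn⟩) g hg
    have h2 : IsOrderPair.elt _ _ a b c d * v *
        IsOrderPair.elt _ _ (a - b + -1 * d) (-b) (-c) (-d) * v = v * (IsOrderPair.elt _ _ a b c d *
          v * IsOrderPair.elt _ _ (a - b + -1 * d) (-b) (-c) (-d)) :=
      congrArg (fun g : isOrderPair_hurwitz.units =>
        (g.1 : QuaternionAlgebra ℚ (-1) 0 (-1))) h1
    rw [elt_hurwitz, elt_hurwitz, ← hm] at h2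
    have hst : (⟨((a - b + -1 * d : ℤ) : ℚ) - ((-b : ℤ) : ℚ) / 2 - ((-d : ℤ) : ℚ) / 2,
        ((-b : ℤ) : ℚ) / 2 + ((-c : ℤ) : ℚ) - ((-d : ℤ) : ℚ) / 2,
        ((-b : ℤ) : ℚ) / 2 + ((-d : ℤ) : ℚ) / 2, ((-b : ℤ) : ℚ) / 2 - ((-d : ℤ) : ℚ) / 2⟩ :
        QuaternionAlgebra ℚ (-1) 0 (-1)) = star m := by
      rw [hm]
      ext <;> simp <;> ring
    rwa [hst] at h2
  -- These are the coordinates of `i`, `j` and `ω` in the basis `1, ω, i, ω i`.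
  have hi := hconj 0 0 1 0 (by norm_num [IsOrderPair.norm]) ⟨0, 1, 0, 0⟩ (by norm_num)
  have hj := hconj 1 1 0 1 (by norm_num [IsOrderPair.norm]) ⟨0, 0, 1, 0⟩ (by norm_num)
  have hω := hconj 0 1 0 0 (by norm_num [IsOrderPair.norm]) ⟨-1 / 2, 1 / 2, 1 / 2, 1 / 2⟩
    (by norm_num)
  obtain ⟨hb, hc, hd⟩ := im_eq_zero_of_commute_conj hi hj hω
  rw [hb, hc, hd, zero_pow two_ne_zero, add_zero, add_zero, add_zero] at hnorm
  rcases eq_or_eq_neg_of_sq_eq_sq v.re 1 (by rw [hnorm, one_pow]) with h1 | h1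
  · left
    ext <;> simp [hb, hc, hd, h1]
  · right
    ext <;> simp [hb, hc, hd, h1]

end Hurwitz

open scoped Classical in
theorem twelve_le_of_isJordanBound {d : ℕ}
    (hd : IsJordanBound (QuaternionAlgebra ℚ (-1) 0 (-1))ˣ d) : 12 ≤ d := by
  have hfin := isOrderPair_hurwitz.finite_units (Or.inr rfl)
  obtain ⟨N, hN, hcomm, hindex⟩ := hd.2 isOrderPair_hurwitz.units hfin
  have hcard : Nat.card N ≤ 2 := by
    let φ : N → ({1, -1} : Finset (QuaternionAlgebra ℚ (-1) 0 (-1))) := fun g =>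
      ⟨(g.1.1 : QuaternionAlgebra ℚ (-1) 0 (-1)), by
        simpa using coe_eq_one_or_neg_one_of_mem_normal hN hcomm g.2⟩
    have hφ : Function.Injective φ := fun g g' heq =>
      Subtype.ext (Subtype.ext (Units.ext (congrArg Subtype.val heq)))
    have := Nat.card_le_card_of_injective φ hφ
    rw [Nat.card_eq_fintype_card (α := ({1, -1} : Finset (QuaternionAlgebra ℚ (-1) 0 (-1)))),
      Fintype.card_coe] at this
    exact this.trans Finset.card_le_two
  have h1 := N.card_mul_index
  have h2 := card_units_hurwitz_ge
  have h3 := Nat.mul_le_mul hcard hindex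
  omega

/-- The pair is `(-1 + j)/2` and `i`. For the lower bound it is enough that these two norm-one
elements of a finite group do not commute. -/
theorem isOrderPair_three : IsOrderPair
    (⟨-1 / 2, 0, 1 / 2, 0⟩ : QuaternionAlgebra ℚ (-1) 0 (-3)) ⟨0, 1, 0, 0⟩ 0 := by
  constructor <;> ext <;> simp <;> norm_num

theorem two_le_of_isJordanBound {d : ℕ}
    (hd : IsJordanBound (QuaternionAlgebra ℚ (-1) 0 (-3))ˣ d) : 2 ≤ d := by
  have hfin := isOrderPair_three.finite_units (Or.inl rfl)
  obtain ⟨N, -, hcomm, hindex⟩ := hd.2 isOrderPair_three.units hfin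
  by_contra! hlt
  have htop : N = ⊤ := by
    rw [← Subgroup.index_eq_one]
    have := N.index_ne_zero_of_finite
    omega
  have h1 := hcomm
    ⟨_, isOrderPair_three.unit_mem 0 1 0 0 (by norm_num [IsOrderPair.norm])⟩ (by simp [htop])
    ⟨_, isOrderPair_three.unit_mem 0 0 1 0 (by norm_num [IsOrderPair.norm])⟩ (by simp [htop])
  have h2 : IsOrderPair.elt _ _ 0 1 0 0 * IsOrderPair.elt _ _ 0 0 1 0 =
      IsOrderPair.elt _ _ 0 0 1 0 * IsOrderPair.elt _ _ 0 1 0 0 :=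
    congrArg (fun g : isOrderPair_three.units => (g.1 : QuaternionAlgebra ℚ (-1) 0 (-3))) h1
  have h3 := congrArg QuaternionAlgebra.imK h2
  norm_num [IsOrderPair.elt] at h3

/-! ### The Jordan constant of `D_{p,∞}` -/

theorem IsJordanBound.of_mulEquiv {G G' : Type*} [Group G] [Group G'] (e : G ≃* G') {d : ℕ}
    (h : IsJordanBound G d) : IsJordanBound G' d := by
  refine ⟨h.1, fun H hH => ?_⟩
  let f : H.comap e.toMonoidHom ≃* H := e.subgroupMap (H.comap e.toMonoidHom) |>.trans
    (MulEquiv.subgroupCongr (Subgroup.map_comap_eq_self_of_surjective e.surjective H))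
  have : Finite (H.comap e.toMonoidHom) := Finite.of_equiv H f.symm.toEquiv
  obtain ⟨N, hN, hcomm, hindex⟩ := h.2 (H.comap e.toMonoidHom) this
  refine ⟨N.map f.toMonoidHom, hN.map _ f.surjective, ?_, ?_⟩
  · rintro _ ⟨x, hx, rfl⟩ _ ⟨y, hy, rfl⟩
    rw [← map_mul, ← map_mul, hcomm x hx y hy]
  · exact (N.index_map_equiv f).le.trans hindex

theorem jordanConstant_eq {G : Type*} [Group G] {d : ℕ} (h : IsJordanBound G d)
    (hmin : ∀ d', IsJordanBound G d' → d ≤ d') : jordanConstant G = d :=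
  le_antisymm (Nat.sInf_le h) (le_csInf ⟨d, h⟩ hmin)

/-- A nonnegative coefficient has a real square root, which gives a zero of the norm form. -/
theorem NormAnisotropic.neg_of_real {A B : ℚ}
    (h : NormAnisotropic (algebraMap ℚ ℝ A) (algebraMap ℚ ℝ B)) : A < 0 ∧ B < 0 := by
  constructor
  · by_contra! hA
    have h0 : (0 : ℝ) ≤ algebraMap ℚ ℝ A := by
      rw [eq_ratCast]
      exact_mod_cast hA
    have := h (Real.sqrt (algebraMap ℚ ℝ A)) 1 0 0 (by rw [Real.sq_sqrt h0]; ring)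
    exact one_ne_zero this.2.1
  · by_contra! hB
    have h0 : (0 : ℝ) ≤ algebraMap ℚ ℝ B := by
      rw [eq_ratCast]
      exact_mod_cast hB
    have := h (Real.sqrt (algebraMap ℚ ℝ B)) 0 1 0 (by rw [Real.sq_sqrt h0]; ring)
    exact one_ne_zero this.2.2.1

theorem IsQuaternionRamifiedAtPInfty.exists_algEquiv {p : ℕ} {D : Type*} [Ring D] [Algebra ℚ D]
    (hD : IsQuaternionRamifiedAtPInfty p D) :
    ∃ A B : ℚ, A < 0 ∧ B < 0 ∧ Nonempty (QuaternionAlgebra ℚ A 0 B ≃ₐ[ℚ] D) ∧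
      ∀ (l : ℕ) [Fact l.Prime], IsRamifiedOver ℚ_[l] (QuaternionAlgebra ℚ A 0 B) ↔ l = p := by
  have := hD.ramified_infty.isDomain
  obtain ⟨i, j, A, B, hi, hj, hij, hi0, hj0⟩ := hD.isQuaternionAlgebra.exists_anticommuting
  obtain ⟨e⟩ := nonempty_algEquiv_of_anticommuting hD.isQuaternionAlgebra.finrank_eq_four
    hi hj hij hi0 hj0
  obtain ⟨hA, hB⟩ := NormAnisotropic.neg_of_real
    ((isRamifiedOver_iff_of_algEquiv e).mp hD.ramified_infty)
  refine ⟨A, B, hA, hB, ⟨e⟩, fun l _ => ?_⟩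
  rw [← hD.ramified_prime_iff l, isRamifiedOver_iff_of_algEquiv e,
    isRamifiedOver_iff_of_algEquiv AlgEquiv.refl]

theorem exists_isJordanBound_of_isQuaternionRamifiedAtPInfty {p : ℕ} (hp : p.Prime) {D : Type*}
    [Ring D] [Algebra ℚ D] (hD : IsQuaternionRamifiedAtPInfty p D) :
    ∃ d, IsJordanBound Dˣ d ∧ (∀ d', IsJordanBound Dˣ d' → d ≤ d') ∧
      (p = 2 ∧ d = 12 ∨ p = 3 ∧ d = 2 ∨ 5 ≤ p ∧ d = 1) := by
  have := Fact.mk hp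
  obtain ⟨A, B, hA, hB, ⟨e⟩, hram⟩ := hD.exists_algEquiv
  have hdom := QuaternionAlgebra.isDomain_of_neg hA hB
  have hE := QuaternionAlgebra.finrank_eq_four A 0 B
  let f := Units.mapEquiv e.toMulEquiv
  have hp4 : p ≠ 4 := by
    rintro rfl
    revert hp
    norm_num
  have h2 := hp.two_le
  obtain rfl | rfl | h5 : p = 2 ∨ p = 3 ∨ 5 ≤ p := by omega
  · refine ⟨12, (isJordanBound_twelve hA hB ((hram 2).mpr rfl)).of_mulEquiv f, fun d' hd' => ?_,
      by simp⟩
    obtain ⟨i, j, hi, hj, hij⟩ := exists_quaternions_of_ramified_two hA hB fun l _ => (hram l).mp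
    have hi0 : i ≠ 0 := by
      rintro rfl
      simp at hi
    have hj0 : j ≠ 0 := by
      rintro rfl
      simp at hj
    obtain ⟨e'⟩ := nonempty_algEquiv_of_anticommuting (A := -1) (B := -1) hE (by simpa using hi)
      (by simpa using hj) hij hi0 hj0
    exact twelve_le_of_isJordanBound
      (hd'.of_mulEquiv (Units.mapEquiv (e'.trans e).toMulEquiv).symm)
  · refine ⟨2, (isJordanBound_two hA hB ((hram 3).mpr rfl)).of_mulEquiv f, fun d' hd' => ?_,
      by simp⟩
    obtain ⟨i, j, hi, hj, hij⟩ := exists_quaternions_of_ramified_three hA hB fun l _ => (hram l).mp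
    have hi0 : i ≠ 0 := by
      rintro rfl
      simp at hi
    have hj0 : j ≠ 0 := by
      rintro rfl
      simp at hj
    obtain ⟨e'⟩ := nonempty_algEquiv_of_anticommuting (A := -1) (B := -3) hE (by simpa using hi)
      hj hij hi0 hj0
    exact two_le_of_isJordanBound
      (hd'.of_mulEquiv (Units.mapEquiv (e'.trans e).toMulEquiv).symm)
  · exact ⟨1, (isJordanBound_one hA hB h5 ((hram p).mpr rfl)).of_mulEquiv f, fun d' hd' => hd'.1,
      by simp [h5]⟩

theorem corollaryQ (p : ℕ) (hp : p.Prime) (D : Type*) [Ring D] [Algebra ℚ D]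
    (hD : IsQuaternionRamifiedAtPInfty p D) :
    IsJordanGroup Dˣ ∧
      (jordanConstant Dˣ = 12 ↔ p = 2) ∧
      (jordanConstant Dˣ = 2 ↔ p = 3) ∧
      (jordanConstant Dˣ = 1 ↔ 5 ≤ p) := by
  obtain ⟨d, hd, hmin, hcases⟩ := exists_isJordanBound_of_isQuaternionRamifiedAtPInfty hp hD
  rw [jordanConstant_eq hd hmin]
  -- The three cases for `p` are exhaustive and the values `12, 2, 1` are distinct, so each value
  -- determines its case.
  refine ⟨⟨d, hd⟩, ?_, ?_, ?_⟩ <;> omega
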